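/- All graphs are finite and simple, and $J\subseteq H$ means that $J$ is a (not necessarily induced or spanning) subgraph of $H$. Write $v(H)$, $e(H)$ and $\chi(H)$ for the number of vertices, the number of edges and the chromatic number of $H$; a graph is non-empty if it has at least one edge. Put $d(H)=e(H)/v(H)$ if $v(H)\ge 1$ and $d(H)=0$ otherwise; $d_1(H)=e(H)/(v(H)-1)$ if $v(H)\ge 2$ and $d_1(H)=0$ otherwise; $d_2(H)=(e(H)-1)/(v(H)-2)$ if $H$ is non-empty and $v(H)\ge 3$, $d_2(H)=1/2$ if $H\cong K_2$, and $d_2(H)=0$ otherwise. Let $$m(H)=\max_{J\subseteq H} d(J),\qquad ar(H)=\max_{J\subseteq H} d_1(J),\qquad m_2(H)=\max_{J\subseteq H} d_2(J).$$ For graphs $H_1,H_2$ put $$d_2(H_1,H_2)=\frac{e(H_1)}{v(H_1)-2+\frac{1}{m_2(H_2)}}\ \text{ if } H_2 \text{ is non-empty and } v(H_1)\ge 2,\qquad d_2(H_1,H_2)=0\ \text{ otherwise,}$$ and $m_2(H_1,H_2)=\max_{J\subseteq H_1} d_2(J,H_2)$. A graph $H$ is strictly $2$-balanced if $d_2(J)<m_2(H)$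 for every proper subgraph $J\subsetneq H$, and $H_1$ is strictly balanced with respect to $d_2(\cdot,H_2)$ if $d_2(J,H_2)<m_2(H_1,H_2)$ for every proper subgraph $J\subsetneq H_1$. A pair $(H_1,H_2)$ with $m_2(H_1)\ge m_2(H_2)$ is a heart if $H_2$ is strictly $2$-balanced and, moreover, $H_1$ is strictly $2$-balanced in case $m_2(H_1)=m_2(H_2)$, and $H_1$ is strictly balanced with respect to $d_2(\cdot,H_2)$ in case $m_2(H_1)>m_2(H_2)$. Write $G\to(H_1,H_2)$ if every colouring of the edges of $G$ with the colours $1$ and $2$ yields a copy of $H_1$ all of whose edges have colour $1$ or a copy of $H_2$ all of whose edges have colour $2$. **Lemma.** Let $G,H_1,H_2$ be graphs such that $m_2(H_1)\ge m_2(H_2)>1$, $m(G)\le m_2(H_1,H_2)$ and $(H_1,H_2)$ is a heart. Then $G\not\to(H_1,H_2)$ if any of the following conditions is satisfied: (i) $m_2(H_1)=m_2(H_2)$; (ii) $\chi(H_2)\ge 3$; (iii) $m(H_2)>2$; (iv) $ar(H_2)>2$; (v) $H_1=K_a$ for some $a\ge 3$; (vi) $H_1=K_{a,b}$ for some $a,b\ge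 2$; (vii) there is $\ell\in\mathbb{N}$ such that $\ell<ar(H_1)$ and $m_2(H_1,H_2)\le \ell+\frac12$; (viii) there is $\ell\in\mathbb{N}$ such that $\ell<m(H_1)$ and $m_2(H_1,H_2)\le \ell+1$, and $H_2$ is not a cycle. -/

import Mathlib

noncomputable section

namespace SimpleGraph

/-- The number of vertices `v(G)`. -/
def numVerts {V : Type*} (_G : SimpleGraph V) : ℕ := Nat.card V

/-- The number of edges `e(G)`. -/
def numEdges {V : Type*} (G : SimpleGraph V) : ℕ := G.edgeSet.ncard

/-- `d(G) = e(G) / v(G)` if `v(G) ≥ 1`, and `0` otherwise. -/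
def density {V : Type*} (G : SimpleGraph V) : ℝ :=
  if 1 ≤ G.numVerts then (G.numEdges : ℝ) / (G.numVerts : ℝ) else 0

/-- `d₁(G) = e(G) / (v(G) - 1)` if `v(G) ≥ 2`, and `0` otherwise. -/
def oneDensity {V : Type*} (G : SimpleGraph V) : ℝ :=
  if 2 ≤ G.numVerts then (G.numEdges : ℝ) / ((G.numVerts : ℝ) - 1) else 0

/-- `d₂(G) = (e(G) - 1) / (v(G) - 2)` if `G` has an edge and `v(G) ≥ 3`, `d₂(G) = 1/2` if `G` is a
single edge (it has an edge and exactly two vertices), and `0` otherwise. -/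
def twoDensity {V : Type*} (G : SimpleGraph V) : ℝ :=
  if 1 ≤ G.numEdges ∧ 3 ≤ G.numVerts then
    ((G.numEdges : ℝ) - 1) / ((G.numVerts : ℝ) - 2)
  else if 1 ≤ G.numEdges ∧ G.numVerts = 2 then 1 / 2
  else 0

/-- `m(G) = max {d(J) : J ⊆ G}`. For finite `G` the supremum is over a finite non-empty family, so
it is a maximum; the same holds for the other three maxima below. -/
def maxDensity {V : Type*} (G : SimpleGraph V) : ℝ :=
  ⨆ J : G.Subgraph, J.coe.density

/-- The arboricity `ar(G) = m₁(G) = max {d₁(J) : J ⊆ G}` (a real number). -/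
def maxOneDensity {V : Type*} (G : SimpleGraph V) : ℝ :=
  ⨆ J : G.Subgraph, J.coe.oneDensity

/-- The 2-density `m₂(G) = max {d₂(J) : J ⊆ G}`. -/
def maxTwoDensity {V : Type*} (G : SimpleGraph V) : ℝ :=
  ⨆ J : G.Subgraph, J.coe.twoDensity

/-- `d₂(G, H) = e(G) / (v(G) - 2 + 1 / m₂(H))` if `H` has an edge and `v(G) ≥ 2`, and `0`
otherwise. -/
def asymTwoDensity {V W : Type*} (G : SimpleGraph V) (H : SimpleGraph W) : ℝ :=
  if 1 ≤ H.numEdges ∧ 2 ≤ G.numVerts then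
    (G.numEdges : ℝ) / ((G.numVerts : ℝ) - 2 + 1 / H.maxTwoDensity)
  else 0

/-- The asymmetric 2-density `m₂(G, H) = max {d₂(J, H) : J ⊆ G}`. -/
def maxAsymTwoDensity {V W : Type*} (G : SimpleGraph V) (H : SimpleGraph W) : ℝ :=
  ⨆ J : G.Subgraph, J.coe.asymTwoDensity H

/-- `G` is strictly 2-balanced: `d₂(J) < m₂(G)` for all proper subgraphs `J` of `G`. -/
def IsStrictlyTwoBalanced {V : Type*} (G : SimpleGraph V) : Prop :=
  ∀ J : G.Subgraph, J < ⊤ → J.coe.twoDensity < G.maxTwoDensity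

/-- `G` is strictly balanced with respect to `d₂(·, H)`: `d₂(J, H) < m₂(G, H)` for all proper
subgraphs `J` of `G`. -/
def IsStrictlyBalancedWrt {V W : Type*} (G : SimpleGraph V) (H : SimpleGraph W) : Prop :=
  ∀ J : G.Subgraph, J < ⊤ → J.coe.asymTwoDensity H < G.maxAsymTwoDensity H

/-- `(H₁, H₂)` is a heart (a notion used for pairs with `m₂(H₁) ≥ m₂(H₂)`). -/
structure IsHeart {V W : Type*} (H₁ : SimpleGraph V) (H₂ : SimpleGraph W) : Prop where
  right_balanced : H₂.IsStrictlyTwoBalanced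
  left_balanced_of_eq :
    H₁.maxTwoDensity = H₂.maxTwoDensity → H₁.IsStrictlyTwoBalanced
  left_balanced_of_gt :
    H₂.maxTwoDensity < H₁.maxTwoDensity → H₁.IsStrictlyBalancedWrt H₂

/-- `G → (H₁, H₂)`: for every colouring of the edges of `G` with two colours there is a copy (not
necessarily induced) of `H₁` in the first colour or a copy of `H₂` in the second colour. -/
def Arrows {U V W : Type*} (G : SimpleGraph U) (H₁ : SimpleGraph V) (H₂ : SimpleGraph W) : Prop :=
  ∀ c : G.EdgeLabeling (Fin 2),
    H₁.IsContained (c.labelGraph 0) ∨ H₂.IsContained (c.labelGraph 1)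

/-- `G` is a cycle, of some length `n ≥ 3`. -/
def IsCycleGraph {V : Type*} (G : SimpleGraph V) : Prop :=
  ∃ n : ℕ, 3 ≤ n ∧ Nonempty (G ≃g cycleGraph n)

end SimpleGraph

end

/-! The colouring comes from a decomposition `G ≤ G₁ ⊔ G₂` with no `H₁` in `G₁` and no `H₂` in `G₂`
(`not_arrows_of_le_sup`). Write `m` for the bound on the maximum density of `G`. Two kinds of
decomposition are used.

Sparse decompositions: `G₁` and `G₂` satisfy edge bounds of the form `k v - L`, and `H₁`, `H₂`
violate the bounds. They rest on `exists_sparse_partition`, a matroid-union argument for two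
intersecting submodular functions, proved by uncrossing. Its instances split `G` into two
pseudoforest-type parts if `m ≤ k₁ + k₂`, into two forest-type parts if `m + 1/2 ≤ k₁ + k₂`, and
into a forest and a part bounded by `k v - L` if `m + L/(2k) < k + 1`.

Degenerate decompositions: `G` is `D`-degenerate once `2m < D + 1`, and vertices are added one at a
time, distributing the at most `D` back edges or colouring the new vertex greedily. Strict
balancedness makes every degree in `H₁` exceed `m`, except for a triangle in the symmetric case, so
`H₁` is not contained in a `⌊m⌋`-degenerate graph; `H₂` is excluded by degrees or by not being
bipartite.

If the two 2-densities agree, then `m` may be taken to be their common value, and triangles,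
non-bipartite graphs and pairs of bipartite graphs are treated separately
(`not_arrows_of_maxTwoDensity_eq`). Otherwise `m = m₂(H₁, H₂) > m₂(H₂)`, and balancedness gives
`e(H₁) > m (v(H₁) - 2) + 1` and `2m < v(H₁) + 1`. These inequalities and the facts `e(H₂) ≥ v(H₂)`,
strict unless `H₂` is a cycle, make the decompositions fit the listed conditions. -/

section

open Finset

namespace SimpleGraph

/-! ### Uncrossing and matroid union for intersecting submodular functions. -/

section EdgeSetFunctions

variable {E : Type*} [DecidableEq E]

/-- Submodularity of a set function on pairs of intersecting sets. -/
def IntersectingSubmodular (f : Finset E → ℤ) : Prop :=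
  ∀ S T : Finset E, (S ∩ T).Nonempty → f (S ∪ T) + f (S ∩ T) ≤ f S + f T

/-- `PartitionCost f A c` says that `A` has a partition into non-empty sets on which the values of
`f` sum to `c`. -/
inductive PartitionCost (f : Finset E → ℤ) : Finset E → ℤ → Prop
  | empty : PartitionCost f ∅ 0
  | insert {T A : Finset E} {c : ℤ} : T.Nonempty → Disjoint T A → PartitionCost f A c →
      PartitionCost f (T ∪ A) (f T + c)

namespace PartitionCost

variable {f : Finset E → ℤ}

theorem single {T : Finset E} (hT : T.Nonempty) : PartitionCost f T (f T) := by
  simpa using PartitionCost.insert (f := f) hT (disjoint_empty_right T) .empty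

theorem disjoint_union {A B : Finset E} {a b : ℤ} (hA : PartitionCost f A a)
    (hB : PartitionCost f B b) (h : Disjoint A B) : PartitionCost f (A ∪ B) (a + b) := by
  induction hA with
  | empty => simpa using hB
  | @insert T A c hT hTA _ ih =>
    rw [disjoint_union_left] at h
    rw [union_assoc, add_assoc]
    exact .insert hT (disjoint_union_right.2 ⟨hTA, h.1⟩) (ih h.2)

/-- `T` swallows, one after another, the parts `P` that it meets: `P ∪ T` takes the place of `T`,
and `P ∩ T` becomes a part of the intersection. Submodularity pays for each exchange. -/
theorem union_inter_single (hf : IntersectingSubmodular f) {A : Finset E} {c : ℤ}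
    (hA : PartitionCost f A c) : ∀ T : Finset E, T.Nonempty →
      ∃ a b, PartitionCost f (A ∪ T) a ∧ PartitionCost f (A ∩ T) b ∧ a + b ≤ c + f T := by
  induction hA with
  | empty => exact fun T hT => ⟨f T, 0, by simpa using single hT, by simpa using .empty, by simp⟩
  | @insert P A c hP hPA _ ih =>
    intro T hT
    rcases (P ∩ T).eq_empty_or_nonempty with h | h
    · obtain ⟨a, b, ha, hb, hab⟩ := ih T hT
      refine ⟨f P + a, b, ?_, ?_, by linarith⟩
      · rw [union_assoc]
        exact .insert hP (disjoint_union_right.2 ⟨hPA, disjoint_iff_inter_eq_empty.2 h⟩) ha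
      · rwa [union_inter_distrib_right, h, empty_union]
    · obtain ⟨a, b, ha, hb, hab⟩ := ih (P ∪ T) (hP.mono subset_union_left)
      rw [inter_union_distrib_left, inter_comm A P, disjoint_iff_inter_eq_empty.1 hPA,
        empty_union] at hb
      refine ⟨a, f (P ∩ T) + b, ?_, ?_, by linarith [hf P T h]⟩
      · rwa [union_comm P A, union_assoc]
      · rw [union_inter_distrib_right]
        exact .insert h (hPA.mono inter_subset_left inter_subset_left) hb

theorem union_inter (hf : IntersectingSubmodular f) {A B : Finset E} {a b : ℤ}
    (hA : PartitionCost f A a) (hB : PartitionCost f B b) :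
    ∃ c d, PartitionCost f (A ∪ B) c ∧ PartitionCost f (A ∩ B) d ∧ c + d ≤ a + b := by
  induction hB with
  | empty => exact ⟨a, 0, by simpa using hA, by simpa using .empty, le_rfl⟩
  | @insert T B b hT hTB _ ih =>
    obtain ⟨c', d', hc', hd', h'⟩ := ih
    obtain ⟨c, e, hc, he, h⟩ := union_inter_single hf hc' T hT
    rw [union_inter_distrib_right, inter_comm B T, disjoint_iff_inter_eq_empty.1 hTB,
      union_empty] at he
    refine ⟨c, e + d', ?_, ?_, by linarith⟩
    · rwa [union_comm T B, ← union_assoc]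
    · rw [inter_union_distrib_left]
      exact he.disjoint_union hd' (hTB.mono inter_subset_right inter_subset_right)

end PartitionCost

/-- Elements common to `S₁` and `S₂` are removed from one of the two sets while the counting
condition is kept. Should both removals of `x` break it, the two violating sets uncross to a
violation of the original condition. -/
theorem exists_sparse_partition_aux {f₁ f₂ : Finset E → ℤ} (h₁ : IntersectingSubmodular f₁)
    (h₂ : IntersectingSubmodular f₂) (n : ℕ) : ∀ S₁ S₂ : Finset E, #(S₁ ∩ S₂) = n →
    (∀ K ⊆ S₁ ∪ S₂, ∀ c₁ c₂, PartitionCost f₁ (K ∩ S₁) c₁ → PartitionCost f₂ (K ∩ S₂) c₂ →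
      (#K : ℤ) ≤ c₁ + c₂) →
    ∃ T₁ T₂, T₁ ∪ T₂ = S₁ ∪ S₂ ∧ (∀ T ⊆ T₁, T.Nonempty → (#T : ℤ) ≤ f₁ T) ∧
      ∀ T ⊆ T₂, T.Nonempty → (#T : ℤ) ≤ f₂ T := by
  induction n with
  | zero =>
    intro S₁ S₂ hn h
    have hd : S₁ ∩ S₂ = ∅ := by simpa using hn
    refine ⟨S₁, S₂, rfl, fun T hT hne => ?_, fun T hT hne => ?_⟩
    · have e₁ : T ∩ S₁ = T := inter_eq_left.2 hT
      have e₂ : T ∩ S₂ = ∅ := subset_empty.1 (hd ▸ inter_subset_inter_right hT)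
      simpa using h T (hT.trans subset_union_left) (f₁ T) 0 (by rw [e₁]; exact .single hne) (e₂ ▸ .empty)
    · have e₁ : T ∩ S₂ = T := inter_eq_left.2 hT
      have e₂ : T ∩ S₁ = ∅ :=
        subset_empty.1 (hd ▸ (inter_comm T S₁ ▸ inter_subset_inter_left hT))
      simpa using h T (hT.trans subset_union_right) 0 (f₂ T) (e₂ ▸ .empty) (by rw [e₁]; exact .single hne)
  | succ n ih =>
    intro S₁ S₂ hn h
    obtain ⟨x, hx⟩ : (S₁ ∩ S₂).Nonempty := card_pos.1 (by omega)
    have hx₁ := (mem_inter.1 hx).1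
    have hx₂ := (mem_inter.1 hx).2
    have u₁ : S₁.erase x ∪ S₂ = S₁ ∪ S₂ := by
      ext y; by_cases hy : y = x <;> simp [hy, hx₁, hx₂]
    have u₂ : S₁ ∪ S₂.erase x = S₁ ∪ S₂ := by
      ext y; by_cases hy : y = x <;> simp [hy, hx₁, hx₂]
    have n₁ : #(S₁.erase x ∩ S₂) = n := by
      rw [erase_inter, card_erase_of_mem hx, hn]; rfl
    have n₂ : #(S₁ ∩ S₂.erase x) = n := by
      rw [inter_erase, card_erase_of_mem hx, hn]; rfl
    by_contra hcon
    have a₁ := mt (ih (S₁.erase x) S₂ n₁) (by rwa [u₁])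
    have a₂ := mt (ih S₁ (S₂.erase x) n₂) (by rwa [u₂])
    rw [u₁] at a₁
    rw [u₂] at a₂
    push Not at a₁ a₂
    obtain ⟨K, hK, c₁, c₂, hc₁, hc₂, hlt⟩ := a₁
    obtain ⟨K', hK', c₁', c₂', hc₁', hc₂', hlt'⟩ := a₂
    -- A violating set that avoids `x` would already violate the original condition.
    have hxK : x ∈ K := by
      by_contra hxK
      have : K ∩ S₁.erase x = K ∩ S₁ := by
        rw [inter_erase, erase_eq_of_notMem (by simp [hxK])]
      exact absurd (h K hK c₁ c₂ (this ▸ hc₁) hc₂) (not_le.2 hlt)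
    have hxK' : x ∈ K' := by
      by_contra hxK
      have : K' ∩ S₂.erase x = K' ∩ S₂ := by
        rw [inter_erase, erase_eq_of_notMem (by simp [hxK])]
      exact absurd (h K' hK' c₁' c₂' hc₁' (this ▸ hc₂')) (not_le.2 hlt')
    obtain ⟨p₁, q₁, hp₁, hq₁, hpq₁⟩ := hc₁.union_inter h₁ hc₁'
    obtain ⟨p₂, q₂, hp₂, hq₂, hpq₂⟩ := hc₂.union_inter h₂ hc₂'
    have e₁ : K ∩ S₁.erase x ∪ K' ∩ S₁ = (K ∪ K') ∩ S₁ := by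
      ext y; by_cases hy : y = x <;> simp [hy, hxK', hx₁]; tauto
    have e₂ : K ∩ S₁.erase x ∩ (K' ∩ S₁) = (K ∩ K').erase x ∩ S₁ := by
      ext y; simp; tauto
    have e₃ : K ∩ S₂ ∪ K' ∩ S₂.erase x = (K ∪ K') ∩ S₂ := by
      ext y; by_cases hy : y = x <;> simp [hy, hxK, hx₂]; tauto
    have e₄ : K ∩ S₂ ∩ (K' ∩ S₂.erase x) = (K ∩ K').erase x ∩ S₂ := by
      ext y; simp; tauto
    rw [e₁] at hp₁
    rw [e₂] at hq₁
    rw [e₃] at hp₂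
    rw [e₄] at hq₂
    -- Two strict integer inequalities leave a deficit of at least 2, while erasing `x` from `K ∩
    -- K'` costs only 1.
    have i₁ := h _ (union_subset hK hK') _ _ hp₁ hp₂
    have i₂ := h _ ((erase_subset _ _).trans (inter_subset_left.trans hK)) _ _ hq₁ hq₂
    have hxm : x ∈ K ∩ K' := mem_inter.2 ⟨hxK, hxK'⟩
    have i₃ := card_erase_add_one hxm
    have i₄ := card_union_add_card_inter K K'
    zify at i₃ i₄
    linarith

/-- If the truncations of two intersecting submodular functions together dominate the cardinality
on all subsets of `S`, then `S` is the union of a set sparse for the first function and a set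
sparse for the second one. -/
theorem exists_sparse_partition {f₁ f₂ : Finset E → ℤ} (h₁ : IntersectingSubmodular f₁)
    (h₂ : IntersectingSubmodular f₂) {S : Finset E}
    (h : ∀ K ⊆ S, ∀ c₁ c₂, PartitionCost f₁ K c₁ → PartitionCost f₂ K c₂ → (#K : ℤ) ≤ c₁ + c₂) :
    ∃ T₁ T₂, T₁ ∪ T₂ = S ∧ (∀ T ⊆ T₁, T.Nonempty → (#T : ℤ) ≤ f₁ T) ∧
      ∀ T ⊆ T₂, T.Nonempty → (#T : ℤ) ≤ f₂ T := by
  have := exists_sparse_partition_aux h₁ h₂ _ S S rfl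
  rw [union_self] at this
  refine this fun K hK c₁ c₂ hc₁ hc₂ => h K hK c₁ c₂ ?_ ?_
  · rwa [inter_eq_left.2 hK] at hc₁
  · rwa [inter_eq_left.2 hK] at hc₂

end EdgeSetFunctions

/-! ### Sparse partitions for the count functions `k v - L`. -/

section Count

variable {E X : Type*} [DecidableEq E] [DecidableEq X] (supp : E → Finset X)

/-- The number of points covered by the edges in `A`. -/
def coverCard (A : Finset E) : ℕ := #(A.biUnion supp)

/-- The count function `k v(A) - L`. -/
def countFun (k L : ℤ) (A : Finset E) : ℤ := k * coverCard supp A - L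

omit [DecidableEq E] in
theorem coverCard_mono {A B : Finset E} (h : A ⊆ B) : coverCard supp A ≤ coverCard supp B :=
  card_le_card (biUnion_subset_biUnion_of_subset_left _ h)

theorem coverCard_union_add_le (A B : Finset E) :
    coverCard supp (A ∪ B) + #(A.biUnion supp ∩ B.biUnion supp) =
      coverCard supp A + coverCard supp B := by
  simp only [coverCard, union_biUnion]
  exact card_union_add_card_inter _ _

theorem coverCard_union_le (A B : Finset E) :
    coverCard supp (A ∪ B) ≤ coverCard supp A + coverCard supp B := by
  have := coverCard_union_add_le supp A B
  omega

theorem coverCard_union_of_disjoint {A B : Finset E}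
    (h : Disjoint (A.biUnion supp) (B.biUnion supp)) :
    coverCard supp (A ∪ B) = coverCard supp A + coverCard supp B := by
  rw [← coverCard_union_add_le, disjoint_iff_inter_eq_empty.1 h]; simp

theorem countFun_intersectingSubmodular {k : ℤ} (hk : 0 ≤ k) (L : ℤ) :
    IntersectingSubmodular (countFun supp k L) := by
  intro A B _
  have h : coverCard supp (A ∩ B) ≤ #(A.biUnion supp ∩ B.biUnion supp) :=
    card_le_card (subset_inter (biUnion_subset_biUnion_of_subset_left _ inter_subset_left)
      (biUnion_subset_biUnion_of_subset_left _ inter_subset_right))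
  have h' := coverCard_union_add_le supp A B
  have : (coverCard supp (A ∪ B) : ℤ) + coverCard supp (A ∩ B) ≤
    coverCard supp A + coverCard supp B := by omega
  unfold countFun
  nlinarith [mul_le_mul_of_nonneg_left this hk]

/-- Like `PartitionCost`, with parts that cover pairwise disjoint sets of points. -/
inductive SeparatedCost (f : Finset E → ℤ) : Finset E → ℤ → Prop
  | empty : SeparatedCost f ∅ 0
  | insert {T A : Finset E} {c : ℤ} : T.Nonempty → Disjoint (T.biUnion supp) (A.biUnion supp) →
      SeparatedCost f A c → SeparatedCost f (T ∪ A) (f T + c)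

variable {supp}

/-- Two parts that share a point may be glued: with `L = k` the union loses at least `k` from the
shared point, which makes up for one fewer subtraction of `L`. -/
theorem SeparatedCost.merge {k : ℤ} (hk : 0 ≤ k) {A : Finset E} {c : ℤ}
    (hA : SeparatedCost supp (countFun supp k k) A c) : ∀ T : Finset E, T.Nonempty →
      ∃ d ≤ countFun supp k k T + c, SeparatedCost supp (countFun supp k k) (T ∪ A) d := by
  induction hA with
  | empty =>
    exact fun T hT => ⟨_, le_rfl, .insert hT (by simp) .empty⟩
  | @insert P A c hP hPA _ ih =>
    intro T hT
    by_cases h : Disjoint (P.biUnion supp) (T.biUnion supp)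
    · obtain ⟨d, hd, hs⟩ := ih T hT
      refine ⟨countFun supp k k P + d, by linarith, ?_⟩
      rw [union_left_comm]
      exact .insert hP (by rw [union_biUnion, disjoint_union_right]; exact ⟨h, hPA⟩) hs
    · obtain ⟨d, hd, hs⟩ := ih (T ∪ P) (hT.mono subset_union_left)
      refine ⟨d, hd.trans ?_, by rwa [← union_assoc]⟩
      rw [disjoint_iff_inter_eq_empty, ← ne_eq, ← nonempty_iff_ne_empty, ← card_pos,
        inter_comm] at h
      have h' := coverCard_union_add_le supp T P
      have : (coverCard supp (T ∪ P) : ℤ) + 1 ≤ coverCard supp T + coverCard supp P := by omega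
      unfold countFun
      nlinarith [mul_le_mul_of_nonneg_left this hk]

theorem PartitionCost.separated {k : ℤ} (hk : 0 ≤ k) {A : Finset E} {c : ℤ}
    (hA : PartitionCost (countFun supp k k) A c) :
    ∃ d ≤ c, SeparatedCost supp (countFun supp k k) A d := by
  induction hA with
  | empty => exact ⟨0, le_rfl, .empty⟩
  | @insert T A c hT _ _ ih =>
    obtain ⟨d, hd, hs⟩ := ih
    obtain ⟨e, he, hs'⟩ := hs.merge hk T hT
    exact ⟨e, by linarith, hs'⟩

/-- Cutting a part along point-disjoint sets preserves the number of covered points and subtracts a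
further `L ≥ 0`, so it does not raise the cost. -/
theorem PartitionCost.split {k L : ℤ} (hL : 0 ≤ L) {K : Finset E} {c : ℤ}
    (hK : PartitionCost (countFun supp k L) K c) : ∀ T A : Finset E, K = T ∪ A →
      Disjoint (T.biUnion supp) (A.biUnion supp) →
      ∃ a b, PartitionCost (countFun supp k L) T a ∧ PartitionCost (countFun supp k L) A b ∧
        a + b ≤ c := by
  induction hK with
  | empty =>
    intro T A h _
    obtain ⟨rfl, rfl⟩ := union_eq_empty.1 h.symm
    exact ⟨0, 0, .empty, .empty, le_rfl⟩
  | @insert P K c hP hPK _ ih =>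
    intro T A h hd
    obtain ⟨a, b, ha, hb, hab⟩ := ih (T ∩ K) (A ∩ K)
      (by rw [← union_inter_distrib_right, ← h]; exact (inter_eq_right.2 subset_union_right).symm)
      (hd.mono (biUnion_subset_biUnion_of_subset_left _ inter_subset_left)
        (biUnion_subset_biUnion_of_subset_left _ inter_subset_left))
    have eT : T = T ∩ P ∪ T ∩ K := by
      rw [← inter_union_distrib_left, h]; exact (inter_eq_left.2 subset_union_left).symm
    have eA : A = A ∩ P ∪ A ∩ K := by
      rw [← inter_union_distrib_left, h]; exact (inter_eq_left.2 subset_union_right).symm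
    have eP : P = T ∩ P ∪ A ∩ P := by
      rw [← union_inter_distrib_right, ← h]; exact (inter_eq_right.2 subset_union_left).symm
    have dT : Disjoint (T ∩ P) (T ∩ K) := hPK.mono inter_subset_right inter_subset_right
    have dA : Disjoint (A ∩ P) (A ∩ K) := hPK.mono inter_subset_right inter_subset_right
    rcases (T ∩ P).eq_empty_or_nonempty with hTP | hTP
    · rw [hTP, empty_union] at eT eP
      rw [← eT] at ha
      refine ⟨a, countFun supp k L P + b, ha, ?_, by linarith⟩
      rw [← eP] at eA dA
      rw [eA]
      exact .insert hP dA hb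
    rcases (A ∩ P).eq_empty_or_nonempty with hAP | hAP
    · rw [hAP, empty_union] at eA
      rw [hAP, union_empty] at eP
      rw [← eA] at hb
      refine ⟨countFun supp k L P + a, b, ?_, hb, by linarith⟩
      rw [← eP] at eT dT
      rw [eT]
      exact .insert hP dT ha
    refine ⟨countFun supp k L (T ∩ P) + a, countFun supp k L (A ∩ P) + b, ?_, ?_, ?_⟩
    · rw [eT]
      convert PartitionCost.insert hTP dT ha using 2
      rw [← eT]
    · rw [eA]
      convert PartitionCost.insert hAP dA hb using 2
      rw [← eA]
    · have := coverCard_union_of_disjoint supp (A := T ∩ P) (B := A ∩ P)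
        (hd.mono (biUnion_subset_biUnion_of_subset_left _ inter_subset_left)
          (biUnion_subset_biUnion_of_subset_left _ inter_subset_left))
      rw [← eP] at this
      unfold countFun
      rw [this]
      push_cast
      linarith

/-- For a union with a forest-like part it suffices to test the trivial partition of
that part. -/
theorem card_le_of_forest_part {k k' L : ℤ} (hk : 0 ≤ k) (hL : 0 ≤ L) {S : Finset E}
    (h : ∀ P ⊆ S, P.Nonempty → ∀ c, PartitionCost (countFun supp k' L) P c →
      (#P : ℤ) ≤ countFun supp k k P + c) :
    ∀ K ⊆ S, ∀ c₁ c₂, PartitionCost (countFun supp k k) K c₁ →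
      PartitionCost (countFun supp k' L) K c₂ → (#K : ℤ) ≤ c₁ + c₂ := by
  intro K hK c₁ c₂ h₁ h₂
  obtain ⟨d, hd, hs⟩ := h₁.separated hk
  suffices (#K : ℤ) ≤ d + c₂ by linarith
  clear h₁ hd
  induction hs generalizing c₂ with
  | empty =>
    generalize hE : (∅ : Finset E) = F at h₂
    cases h₂ with
    | empty => simp
    | insert hT _ _ => exact absurd (union_eq_empty.1 hE.symm).1 hT.ne_empty
  | @insert T A c hT hTA _ ih =>
    -- The second partition is cut along the point-disjoint parts of the first, and the hypothesis
    -- is applied to each part.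
    obtain ⟨a, b, ha, hb, hab⟩ := h₂.split hL T A rfl hTA
    have i₁ := h T (subset_union_left.trans hK) hT a ha
    have i₂ := ih (subset_union_right.trans hK) b hb
    have i₃ := card_union_le T A
    zify at i₃
    linarith

/-- A Nash-Williams type condition. Once one partition is trivial and the other is separated, the
bound is summed over the separated parts. -/
theorem exists_forest_forest_partition {k₁ k₂ : ℤ} (h₁ : 0 ≤ k₁) (h₂ : 0 ≤ k₂) {S : Finset E}
    (h : ∀ P ⊆ S, P.Nonempty → (#P : ℤ) ≤ countFun supp (k₁ + k₂) (k₁ + k₂) P) :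
    ∃ T₁ T₂, T₁ ∪ T₂ = S ∧ (∀ T ⊆ T₁, T.Nonempty → (#T : ℤ) ≤ countFun supp k₁ k₁ T) ∧
      ∀ T ⊆ T₂, T.Nonempty → (#T : ℤ) ≤ countFun supp k₂ k₂ T := by
  refine exists_sparse_partition (countFun_intersectingSubmodular supp h₁ _)
    (countFun_intersectingSubmodular supp h₂ _) (card_le_of_forest_part h₁ h₂ ?_)
  intro P hP hne c hc
  obtain ⟨d, hd, hs⟩ := hc.separated h₂
  suffices (#P : ℤ) ≤ countFun supp k₁ k₁ P + d by linarith
  clear hc hd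
  -- The empty set is a separate alternative because `countFun` takes the value `-k₁` there.
  have key : ∀ (P : Finset E) (d : ℤ), SeparatedCost supp (countFun supp k₂ k₂) P d → P ⊆ S →
      (P = ∅ ∧ d = 0) ∨ (#P : ℤ) ≤ countFun supp k₁ k₁ P + d := by
    intro P d hs
    induction hs with
    | empty => exact fun _ => .inl ⟨rfl, rfl⟩
    | @insert T A c hT hTA _ ih =>
      intro hS
      right
      have i₁ := h T (subset_union_left.trans hS) hT
      have i₂ := coverCard_union_of_disjoint supp hTA
      have i₃ := card_union_le T A
      zify at i₃
      rcases ih (subset_union_right.trans hS) with ⟨rfl, rfl⟩ | h'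
      · rw [union_empty]
        unfold countFun at *
        linarith
      · unfold countFun at *
        rw [i₂]
        push_cast
        linarith
  rcases key P d hs hP with ⟨rfl, _⟩ | h'
  · simp at hne
  · exact h'

/-- For `L = 0` the count is subadditive, so no partition is cheaper than the trivial one. -/
theorem PartitionCost.mul_coverCard_le {k : ℤ} (hk : 0 ≤ k) {K : Finset E} {c : ℤ}
    (hK : PartitionCost (countFun supp k 0) K c) : k * coverCard supp K ≤ c := by
  induction hK with
  | empty => simp [coverCard]
  | @insert T A c hT _ _ ih =>
    have := coverCard_union_le supp T A
    have := mul_le_mul_of_nonneg_left (Nat.cast_le (α := ℤ).2 this) hk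
    push_cast at this
    unfold countFun
    linarith

theorem exists_pseudoforest_partition {k₁ k₂ : ℤ} (h₁ : 0 ≤ k₁) (h₂ : 0 ≤ k₂) {S : Finset E}
    (h : ∀ P ⊆ S, P.Nonempty → (#P : ℤ) ≤ countFun supp (k₁ + k₂) 0 P) :
    ∃ T₁ T₂, T₁ ∪ T₂ = S ∧ (∀ T ⊆ T₁, T.Nonempty → (#T : ℤ) ≤ countFun supp k₁ 0 T) ∧
      ∀ T ⊆ T₂, T.Nonempty → (#T : ℤ) ≤ countFun supp k₂ 0 T := by
  refine exists_sparse_partition (countFun_intersectingSubmodular supp h₁ _)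
    (countFun_intersectingSubmodular supp h₂ _) ?_
  intro K hK c₁ c₂ hc₁ hc₂
  have i₁ := hc₁.mul_coverCard_le h₁
  have i₂ := hc₂.mul_coverCard_le h₂
  rcases K.eq_empty_or_nonempty with rfl | hne
  · simp [coverCard] at i₁ i₂ ⊢
    linarith
  · have := h K hK hne
    unfold countFun at this
    linarith

/-- If every set `A` of edges has at most `m v(A)` elements, where `m + L / 2k < k + 1`, then
the edges decompose into a forest and a part counted by `k v - L`. -/
theorem exists_forest_count_partition {k L : ℕ} {m : ℝ} (hk : 1 ≤ k) (hL : L < 2 * k)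
    (hm : m + (L : ℝ) / (2 * k) < k + 1) {S : Finset E}
    (hcard : ∀ P ⊆ S, P.Nonempty →
      2 ≤ coverCard supp P ∧ 2 * #P ≤ coverCard supp P * (coverCard supp P - 1))
    (h : ∀ P ⊆ S, (#P : ℝ) ≤ m * coverCard supp P) :
    ∃ T₁ T₂, T₁ ∪ T₂ = S ∧ (∀ T ⊆ T₁, T.Nonempty → (#T : ℤ) ≤ countFun supp 1 1 T) ∧
      ∀ T ⊆ T₂, T.Nonempty → (#T : ℤ) ≤ countFun supp k L T := by
  refine exists_sparse_partition (countFun_intersectingSubmodular supp zero_le_one _)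
    (countFun_intersectingSubmodular supp (by positivity) _)
    (card_le_of_forest_part zero_le_one (by positivity) ?_)
  have hk0 : (0 : ℝ) < k := by exact_mod_cast hk
  -- `B` is the union of the parts that cover at least `2k` points, and `s` is the sum of their
  -- numbers of points.
  have key : ∀ (A : Finset E) (c : ℤ), PartitionCost (countFun supp k L) A c → A ⊆ S →
      ∃ B ⊆ A, ∃ s : ℝ, (coverCard supp B : ℝ) ≤ s ∧
        (#A : ℝ) ≤ #B + c - (k - (L : ℝ) / (2 * k)) * s := by
    intro A c hA
    induction hA with
    | empty => exact fun _ => ⟨∅, subset_rfl, 0, by simp [coverCard], by simp⟩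
    | @insert T A c hT hTA _ ih =>
      intro hS
      obtain ⟨B, hBA, s, hs, hle⟩ := ih (subset_union_right.trans hS)
      obtain ⟨hv2, hc⟩ := hcard T (subset_union_left.trans hS) hT
      have hcardU : (#(T ∪ A) : ℝ) = #T + #A := by
        rw [card_union_of_disjoint hTA]; push_cast; ring
      by_cases hv : coverCard supp T < 2 * k
      · refine ⟨B, hBA.trans subset_union_right, s, hs, ?_⟩
        -- A part on `v < 2k` points has at most `v(v-1)/2 ≤ k v - L` edges since `L < 2k`; it pays
        -- for itself and is dropped.
        have hTf : (#T : ℤ) ≤ countFun supp k L T := by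
          unfold countFun
          generalize coverCard supp T = v at *
          obtain ⟨w, rfl⟩ : ∃ w, v = w + 2 := ⟨v - 2, by omega⟩
          have : w + 2 - 1 = w + 1 := by omega
          rw [this] at hc
          zify at hc hv hL ⊢
          nlinarith [mul_nonneg (Nat.cast_nonneg (α := ℤ) w)
            (show (0 : ℤ) ≤ 2 * k - 3 - w by linarith)]
        have hTf' : (#T : ℝ) ≤ (countFun supp k L T : ℤ) := by exact_mod_cast hTf
        push_cast
        linarith
      · refine ⟨T ∪ B, union_subset_union_right hBA, coverCard supp T + s, ?_, ?_⟩
        · have := coverCard_union_le supp T B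
          have : (coverCard supp (T ∪ B) : ℝ) ≤ coverCard supp T + coverCard supp B := by
            exact_mod_cast this
          linarith
        · have hcB : (#(T ∪ B) : ℝ) = #T + #B := by
            rw [card_union_of_disjoint (hTA.mono_right hBA)]; push_cast; ring
          have hv' : (2 * k : ℝ) ≤ coverCard supp T := by exact_mod_cast not_lt.1 hv
          -- On a part with at least `2k` points, the constant `L` is charged to the points at rate
          -- `L/(2k)`.
          have hq : (L : ℝ) ≤ (L : ℝ) / (2 * k) * coverCard supp T := by
            calc (L : ℝ) = (L : ℝ) / (2 * k) * (2 * k) := by field_simp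
              _ ≤ _ := by gcongr
          have hf : ((countFun supp k L T : ℤ) : ℝ) = k * coverCard supp T - L := by
            simp [countFun]
          push_cast
          rw [hcardU, hcB, hf]
          linarith
  intro P hP hne c hc
  obtain ⟨B, hBP, s, hs, hle⟩ := key P c hc hP
  have hB := h B (hBP.trans hP)
  have hpos : 0 ≤ (k : ℝ) - (L : ℝ) / (2 * k) := by
    rw [sub_nonneg, div_le_iff₀ (by positivity)]
    have h1 : (L : ℝ) ≤ 2 * k := by exact_mod_cast hL.le
    have h2 : (1 : ℝ) ≤ k := by exact_mod_cast hk
    nlinarith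
  have h1 := mul_le_mul_of_nonneg_left hs hpos
  have hvP := (hcard P hP hne).1
  -- Strictness is what produces the `-1` of the forest count after the return to integers.
  have hlt : (#P : ℝ) < coverCard supp P + c := by
    rcases (Nat.zero_le (coverCard supp B)).eq_or_lt with h0 | h0
    · rw [← h0] at hB h1
      have : (2 : ℝ) ≤ coverCard supp P := by exact_mod_cast hvP
      push_cast at *
      linarith
    · have h3 : (0 : ℝ) < coverCard supp B := by exact_mod_cast h0
      have h4 : (coverCard supp B : ℝ) ≤ coverCard supp P := by
        exact_mod_cast coverCard_mono supp hBP
      have h5 : (m - (k - (L : ℝ) / (2 * k))) * coverCard supp B < 1 * coverCard supp B :=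
        mul_lt_mul_of_pos_right (by linarith) h3
      linarith
  have : (#P : ℤ) < coverCard supp P + c := by exact_mod_cast hlt
  unfold countFun
  linarith

end Count

end SimpleGraph

end

section

open Finset
open scoped Classical

namespace SimpleGraph

/-! ### Vertex and edge counts of subgraphs and copies. -/

section Transfer

variable {V W : Type*} {G : SimpleGraph V} {H : SimpleGraph W}

theorem numVerts_congr (e : H ≃g G) : H.numVerts = G.numVerts := Nat.card_congr e.toEquiv

theorem numEdges_congr (e : H ≃g G) : H.numEdges = G.numEdges := by
  unfold numEdges
  rw [← Nat.card_coe_set_eq, ← Nat.card_coe_set_eq]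
  exact Nat.card_congr e.mapEdgeSet

theorem numVerts_coe (J : G.Subgraph) : J.coe.numVerts = J.verts.ncard :=
  Nat.card_coe_set_eq _

theorem numEdges_coe (J : G.Subgraph) : J.coe.numEdges = J.edgeSet.ncard := by
  unfold numEdges
  rw [← Subgraph.image_coe_edgeSet_coe,
    Set.ncard_image_of_injective _ (Sym2.map.injective Subtype.val_injective)]

theorem numVerts_coe_top : (⊤ : G.Subgraph).coe.numVerts = G.numVerts :=
  numVerts_congr Subgraph.topIso

theorem numEdges_coe_top : (⊤ : G.Subgraph).coe.numEdges = G.numEdges :=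
  numEdges_congr Subgraph.topIso

theorem numEdges_eq_card [Fintype V] : G.numEdges = #G.edgeFinset := by
  rw [numEdges, ← coe_edgeFinset, Set.ncard_coe_finset]

theorem two_mul_numEdges_le [Finite V] : 2 * G.numEdges ≤ G.numVerts * (G.numVerts - 1) := by
  have := Fintype.ofFinite V
  have h := G.card_edgeFinset_le_card_choose_two
  rw [Nat.choose_two_right] at h
  rw [numEdges_eq_card, numVerts, Nat.card_eq_fintype_card]
  have := Nat.div_mul_le_self (Fintype.card V * (Fintype.card V - 1)) 2
  omega

theorem numEdges_le_maxDensity_mul [Finite V] (J : G.Subgraph) :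
    (J.coe.numEdges : ℝ) ≤ G.maxDensity * J.coe.numVerts := by
  have hle : J.coe.density ≤ G.maxDensity :=
    le_ciSup (f := fun J : G.Subgraph => J.coe.density) (Set.finite_range _).bddAbove J
  unfold density at hle
  have h2 := two_mul_numEdges_le (G := J.coe)
  split_ifs at hle with h
  · rwa [div_le_iff₀ (by exact_mod_cast h)] at hle
  · have h0 : J.coe.numVerts = 0 := by omega
    rw [h0] at h2 ⊢
    have : J.coe.numEdges = 0 := by omega
    simp [this]

theorem IsContained.numEdges_le_maxDensity_mul [Finite V] (h : H ⊑ G) :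
    (H.numEdges : ℝ) ≤ G.maxDensity * H.numVerts := by
  obtain ⟨J, ⟨e⟩⟩ := h.exists_iso_subgraph
  rw [numEdges_congr e, numVerts_congr e]
  exact SimpleGraph.numEdges_le_maxDensity_mul J

end Transfer

section Colourings

variable {U V W : Type*} {G : SimpleGraph U} {H₁ : SimpleGraph V} {H₂ : SimpleGraph W}

theorem not_arrows_of_le_sup {G₁ G₂ : SimpleGraph U} (h : G ≤ G₁ ⊔ G₂) (h₁ : ¬ H₁ ⊑ G₁)
    (h₂ : ¬ H₂ ⊑ G₂) : ¬ G.Arrows H₁ H₂ := by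
  intro hA
  rcases hA (fun e => if (e : Sym2 U) ∈ G₁.edgeSet then 0 else 1) with h' | h'
  · refine h₁ (h'.mono_right fun x y hxy => ?_)
    obtain ⟨_, he⟩ := (EdgeLabeling.labelGraph_adj _ _).1 hxy
    by_contra hc
    simp [hc] at he
  · refine h₂ (h'.mono_right fun x y hxy => ?_)
    obtain ⟨ha, he⟩ := (EdgeLabeling.labelGraph_adj _ _).1 hxy
    rcases h ha with hb | hb
    · simp [hb] at he
    · exact hb

end Colourings

/-! ### Decompositions of a graph into sparse graphs. -/

section Sparse

variable {U W : Type*}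

/-- Every non-empty set `A` of edges of `G` has at most `k v(A) - L` elements. -/
def IsSparse (k L : ℤ) (G : SimpleGraph U) : Prop :=
  ∀ A : Finset (Sym2 U), (A : Set (Sym2 U)) ⊆ G.edgeSet → A.Nonempty →
    (#A : ℤ) ≤ countFun Sym2.toFinset k L A

theorem IsSparse.numEdges_le [Finite W] {k L : ℤ} {G : SimpleGraph U} {H : SimpleGraph W}
    (hG : IsSparse k L G) (hk : 0 ≤ k) (h : H ⊑ G) (he : 1 ≤ H.numEdges) :
    (H.numEdges : ℤ) ≤ k * H.numVerts - L := by
  have := Fintype.ofFinite W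
  obtain ⟨f⟩ := h
  have hinj : Function.Injective (Sym2.map f) := Sym2.map.injective f.injective
  have hcard : #(H.edgeFinset.image (Sym2.map f)) = H.numEdges := by
    rw [card_image_of_injective _ hinj, numEdges_eq_card]
  have h1 := hG (H.edgeFinset.image (Sym2.map f)) (by
    intro e he
    simp only [coe_image, coe_edgeFinset, Set.mem_image] at he
    obtain ⟨e, he, rfl⟩ := he
    induction e with
    | _ x y => exact f.toHom.map_adj he) (card_pos.1 (by omega))
  have h2 : coverCard Sym2.toFinset (H.edgeFinset.image (Sym2.map f)) ≤ H.numVerts := by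
    rw [numVerts, Nat.card_eq_fintype_card, ← card_univ, ← card_image_of_injective univ f.injective]
    refine card_le_card fun x hx => ?_
    simp only [mem_biUnion, mem_image, exists_exists_and_eq_and, Sym2.mem_toFinset,
      Sym2.mem_map] at hx
    obtain ⟨e, _, y, _, rfl⟩ := hx
    exact mem_image_of_mem _ (mem_univ y)
  rw [hcard] at h1
  unfold countFun at h1
  have := mul_le_mul_of_nonneg_left (Nat.cast_le (α := ℤ).2 h2) hk
  linarith

theorem IsSparse.not_isContained [Finite W] {k L : ℤ} {G : SimpleGraph U} {H : SimpleGraph W}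
    (hG : IsSparse k L G) (hk : 0 ≤ k) (J : H.Subgraph) (he : 1 ≤ J.coe.numEdges)
    (hJ : k * J.coe.numVerts - L < J.coe.numEdges) : ¬ H ⊑ G := fun h =>
  absurd (hG.numEdges_le hk (J.coe_isContained.trans h) he) (not_le.2 hJ)

theorem IsSparse.not_isContained_self [Finite W] {k L : ℤ} {G : SimpleGraph U} {H : SimpleGraph W}
    (hG : IsSparse k L G) (hk : 0 ≤ k) (he : 1 ≤ H.numEdges)
    (hJ : k * H.numVerts - L < H.numEdges) : ¬ H ⊑ G := fun h =>
  absurd (hG.numEdges_le hk h he) (not_le.2 hJ)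

theorem isSparse_fromEdgeSet {k L : ℤ} {S : Finset (Sym2 U)}
    (h : ∀ T ⊆ S, T.Nonempty → (#T : ℤ) ≤ countFun Sym2.toFinset k L T) :
    IsSparse k L (fromEdgeSet (S : Set (Sym2 U))) := by
  intro A hA hne
  refine h A (fun e he => ?_) hne
  have := hA he
  rw [edgeSet_fromEdgeSet] at this
  exact this.1

variable [Fintype U] {G : SimpleGraph U}

theorem le_sup_fromEdgeSet {S T : Finset (Sym2 U)} (h : S ∪ T = G.edgeFinset) :
    G ≤ fromEdgeSet (S : Set (Sym2 U)) ⊔ fromEdgeSet (T : Set (Sym2 U)) := by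
  intro x y hxy
  have : s(x, y) ∈ S ∪ T := by rw [h]; simpa using hxy
  rcases mem_union.1 this with h | h
  · exact .inl ⟨h, hxy.ne⟩
  · exact .inr ⟨h, hxy.ne⟩

/-- The subgraph with edge set `A` and without isolated vertices. -/
def edgeSubgraph {A : Finset (Sym2 U)} (hA : A ⊆ G.edgeFinset) : G.Subgraph where
  verts := {x | ∃ e ∈ A, x ∈ e}
  Adj x y := s(x, y) ∈ A
  adj_sub h := by simpa using hA h
  edge_vert h := ⟨_, h, Sym2.mem_mk_left _ _⟩
  symm := ⟨fun x y h => by rwa [Sym2.eq_swap]⟩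

theorem numVerts_edgeSubgraph {A : Finset (Sym2 U)} (hA : A ⊆ G.edgeFinset) :
    (edgeSubgraph hA).coe.numVerts = coverCard Sym2.toFinset A := by
  rw [numVerts_coe, coverCard, ← Set.ncard_coe_finset]
  congr 1
  ext x
  simp [edgeSubgraph]

theorem numEdges_edgeSubgraph {A : Finset (Sym2 U)} (hA : A ⊆ G.edgeFinset) :
    (edgeSubgraph hA).coe.numEdges = #A := by
  rw [numEdges_coe, ← Set.ncard_coe_finset]
  congr 1
  ext e
  induction e with
  | _ x y => rfl

theorem two_mul_card_le {A : Finset (Sym2 U)} (hA : A ⊆ G.edgeFinset) :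
    2 * #A ≤ coverCard Sym2.toFinset A * (coverCard Sym2.toFinset A - 1) := by
  rw [← numVerts_edgeSubgraph hA, ← numEdges_edgeSubgraph hA]
  exact two_mul_numEdges_le

theorem two_le_coverCard {A : Finset (Sym2 U)} (hA : A ⊆ G.edgeFinset) (hne : A.Nonempty) :
    2 ≤ coverCard Sym2.toFinset A := by
  have h := two_mul_card_le hA
  have := hne.card_pos
  by_contra hc
  have : coverCard Sym2.toFinset A = 0 ∨ coverCard Sym2.toFinset A = 1 := by omega
  rcases this with h' | h' <;> simp [h'] at h <;> simp [h] at hne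

theorem card_le_maxDensity_mul {A : Finset (Sym2 U)} (hA : A ⊆ G.edgeFinset) :
    (#A : ℝ) ≤ G.maxDensity * coverCard Sym2.toFinset A := by
  rw [← numVerts_edgeSubgraph hA, ← numEdges_edgeSubgraph hA]
  exact numEdges_le_maxDensity_mul _

/-- Decomposition into two graphs of bounded maximum density. -/
theorem exists_isSparse_zero_zero {k₁ k₂ : ℕ} (h : G.maxDensity ≤ k₁ + k₂) :
    ∃ G₁ G₂ : SimpleGraph U, G ≤ G₁ ⊔ G₂ ∧ IsSparse k₁ 0 G₁ ∧ IsSparse k₂ 0 G₂ := by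
  obtain ⟨T₁, T₂, hT, h₁, h₂⟩ := exists_pseudoforest_partition (supp := Sym2.toFinset)
    (S := G.edgeFinset) (Nat.cast_nonneg (α := ℤ) k₁) (Nat.cast_nonneg (α := ℤ) k₂) (by
      intro P hP _
      have := (card_le_maxDensity_mul hP).trans (mul_le_mul_of_nonneg_right h (Nat.cast_nonneg _))
      unfold countFun
      rw [sub_zero]
      exact_mod_cast this)
  exact ⟨_, _, le_sup_fromEdgeSet hT, isSparse_fromEdgeSet h₁, isSparse_fromEdgeSet h₂⟩

/-- Decomposition into two graphs of bounded arboricity. -/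
theorem exists_isSparse_self_self {k₁ k₂ : ℕ} (h : G.maxDensity + 1 / 2 ≤ k₁ + k₂) :
    ∃ G₁ G₂ : SimpleGraph U, G ≤ G₁ ⊔ G₂ ∧ IsSparse k₁ k₁ G₁ ∧ IsSparse k₂ k₂ G₂ := by
  obtain ⟨T₁, T₂, hT, h₁, h₂⟩ := exists_forest_forest_partition (supp := Sym2.toFinset)
    (S := G.edgeFinset) (Nat.cast_nonneg (α := ℤ) k₁) (Nat.cast_nonneg (α := ℤ) k₂) (by
      intro P hP hne
      have i₁ := card_le_maxDensity_mul hP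
      have i₂ := two_mul_card_le hP
      have i₃ := two_le_coverCard hP hne
      unfold countFun
      generalize coverCard Sym2.toFinset P = v at *
      obtain ⟨w, rfl⟩ : ∃ w, v = w + 1 := ⟨v - 1, by omega⟩
      rw [Nat.add_sub_cancel] at i₂
      have i₂' : (2 * #P : ℝ) ≤ (w + 1) * w := by exact_mod_cast i₂
      have hw : (1 : ℝ) ≤ w := by exact_mod_cast (by omega : 1 ≤ w)
      push_cast at i₁
      have : (#P : ℝ) ≤ (k₁ + k₂) * w := by
        -- This is `w` times the density bound plus the trivial bound `#P ≤ w(w+1)/2`; the latter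
        -- accounts for the extra `1/2`.
        have h1 : (#P : ℝ) * (w + 1) ≤ (G.maxDensity + 1 / 2) * w * (w + 1) := by nlinarith
        have h2 := le_of_mul_le_mul_right h1 (by linarith)
        exact h2.trans (mul_le_mul_of_nonneg_right h (by linarith))
      have : (#P : ℤ) ≤ (k₁ + k₂) * w := by exact_mod_cast this
      push_cast
      linarith)
  exact ⟨_, _, le_sup_fromEdgeSet hT, isSparse_fromEdgeSet h₁, isSparse_fromEdgeSet h₂⟩

theorem exists_isSparse_forest_count {k L : ℕ} (hk : 1 ≤ k) (hL : L < 2 * k)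
    (hm : G.maxDensity + (L : ℝ) / (2 * k) < k + 1) :
    ∃ G₁ G₂ : SimpleGraph U, G ≤ G₁ ⊔ G₂ ∧ IsSparse k L G₁ ∧ IsSparse 1 1 G₂ := by
  obtain ⟨T₁, T₂, hT, h₁, h₂⟩ := exists_forest_count_partition (supp := Sym2.toFinset)
    (S := G.edgeFinset) hk hL hm
    (fun P hP hne => ⟨two_le_coverCard hP hne, two_mul_card_le hP⟩)
    (fun P hP => card_le_maxDensity_mul hP)
  rw [union_comm] at hT
  exact ⟨_, _, le_sup_fromEdgeSet hT, isSparse_fromEdgeSet h₂, isSparse_fromEdgeSet h₁⟩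

end Sparse

/-! ### Degenerate graphs and their decompositions. -/

section Degenerate

variable {U W : Type*}

/-- Every non-empty set `T` of vertices contains a vertex with at most `t` neighbours in `T`. -/
def IsDegenerate (t : ℕ) (G : SimpleGraph U) : Prop :=
  ∀ T : Finset U, T.Nonempty → ∃ v ∈ T, #{w ∈ T | G.Adj v w} ≤ t

theorem IsDegenerate.not_isContained [Finite W] [Nonempty W] {t : ℕ} {G : SimpleGraph U}
    {H : SimpleGraph W} (hG : IsDegenerate t G) (hH : ∀ x, t < (H.neighborSet x).ncard) :
    ¬ H ⊑ G := by
  rintro ⟨f⟩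
  have := Fintype.ofFinite W
  obtain ⟨v, hv, hle⟩ := hG (univ.image f) (univ_nonempty.image _)
  obtain ⟨x, _, rfl⟩ := mem_image.1 hv
  refine absurd (hH x) (not_lt.2 (le_trans ?_ hle))
  rw [← Set.ncard_image_of_injective _ f.injective, ← Set.ncard_coe_finset]
  refine Set.ncard_le_ncard ?_ (finite_toSet _)
  rintro _ ⟨y, hy, rfl⟩
  simpa using f.toHom.map_adj hy

/-- Every non-empty induced subgraph has average degree at most `2 m(G) < D + 1`. -/
theorem isDegenerate_of_maxDensity [Finite U] {G : SimpleGraph U} {D : ℕ}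
    (h : 2 * G.maxDensity < D + 1) : IsDegenerate D G := by
  have := Fintype.ofFinite U
  intro T hT
  by_contra! hc
  set H := G.induce (T : Set U)
  have h1 : (H.numEdges : ℝ) ≤ G.maxDensity * H.numVerts :=
    IsContained.numEdges_le_maxDensity_mul ⟨Copy.induce G _⟩
  have h2 : H.numVerts = #T := by simp [numVerts]
  have h3 := H.sum_degrees_eq_twice_card_edges
  have h4 : ∀ v : (T : Set U), D + 1 ≤ H.degree v := by
    intro v
    refine Nat.succ_le_of_lt ((hc v v.2).trans_le ?_)
    rw [← card_neighborFinset_eq_degree, ← card_map (Function.Embedding.subtype _)]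
    refine card_le_card fun w hw => ?_
    simp only [mem_filter] at hw
    simp only [mem_map, mem_neighborFinset, Function.Embedding.subtype_apply]
    exact ⟨⟨w, hw.1⟩, hw.2, rfl⟩
  have h5 := card_nsmul_le_sum univ (fun v => H.degree v) (D + 1) (fun v _ => h4 v)
  have h8 : H.numEdges = #H.edgeFinset := by rw [numEdges_eq_card]; congr!
  rw [h3, ← h8, smul_eq_mul, card_univ, ← Nat.card_eq_fintype_card] at h5
  change H.numVerts * (D + 1) ≤ _ at h5
  rw [h2] at h5 h1
  have h6 : (0 : ℝ) < #T := by exact_mod_cast hT.card_pos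
  have h7 : (#T * (D + 1) : ℝ) ≤ 2 * H.numEdges := by exact_mod_cast h5
  nlinarith

theorem IsDegenerate.induction {G : SimpleGraph U} {D : ℕ} (hG : IsDegenerate D G)
    {P : Finset U → Prop} (empty : P ∅)
    (insert : ∀ (S : Finset U) (u : U), u ∉ S → #{w ∈ S | G.Adj u w} ≤ D → P S →
      P (insert u S)) (S : Finset U) : P S := by
  induction S using Finset.strongInduction with
  | H S ih =>
    rcases S.eq_empty_or_nonempty with rfl | hS
    · exact empty
    · obtain ⟨u, hu, hle⟩ := hG S hS
      rw [← insert_erase hu]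
      refine insert _ u (notMem_erase u S) (le_trans (card_le_card ?_) hle) (ih _ (erase_ssubset hu))
      exact filter_subset_filter _ (erase_subset _ _)

/-- The star with centre `u` and leaves `N`. -/
def starGraphOn (u : U) (N : Finset U) : SimpleGraph U :=
  fromRel fun x y => x = u ∧ y ∈ N

theorem starGraphOn_adj_left {u y : U} {N : Finset U} (hu : u ∉ N) :
    (starGraphOn u N).Adj u y ↔ y ∈ N := by
  rw [starGraphOn, fromRel_adj]
  constructor
  · rintro ⟨_, h | h⟩
    · exact h.2
    · exact absurd h.2 hu
  · intro h
    exact ⟨fun e => hu (e ▸ h), .inl ⟨rfl, h⟩⟩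

theorem not_starGraphOn_adj {u x y : U} {N : Finset U} (hx : x ≠ u) (hy : y ≠ u) :
    ¬ (starGraphOn u N).Adj x y := by
  simp [starGraphOn, hx, hy]

theorem IsDegenerate.sup_star {G : SimpleGraph U} {t : ℕ} (hG : IsDegenerate t G) {u : U}
    (hu : ∀ y, ¬ G.Adj u y) {N : Finset U} (huN : u ∉ N) (hN : #N ≤ t) :
    IsDegenerate t (G ⊔ starGraphOn u N) := by
  intro T hT
  by_cases huT : u ∈ T
  · refine ⟨u, huT, le_trans (card_le_card fun w hw => ?_) hN⟩
    simp only [mem_filter] at hw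
    rcases hw.2 with h | h
    · exact absurd h (hu w)
    · exact (starGraphOn_adj_left huN).1 h
  · obtain ⟨v, hv, hle⟩ := hG T hT
    refine ⟨v, hv, le_trans (card_le_card fun w hw => ?_) hle⟩
    simp only [mem_filter] at hw ⊢
    refine ⟨hw.1, hw.2.resolve_right (not_starGraphOn_adj ?_ ?_)⟩
    · exact fun e => huT (e ▸ hv)
    · exact fun e => huT (e ▸ hw.1)

theorem isDegenerate_bot (t : ℕ) : IsDegenerate t (⊥ : SimpleGraph U) := by
  rintro T ⟨v, hv⟩
  exact ⟨v, hv, by simp⟩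

/-- A vertex-by-vertex construction of a decomposition of a degenerate graph. -/
theorem IsDegenerate.exists_decomposition {G : SimpleGraph U} [Finite U] {D : ℕ}
    (hG : IsDegenerate D G) {P : SimpleGraph U → SimpleGraph U → Prop} (bot : P ⊥ ⊥)
    (step : ∀ (G₁ G₂ : SimpleGraph U) (u : U) (N : Finset U), (∀ y, ¬ G₁.Adj u y) →
      (∀ y, ¬ G₂.Adj u y) → u ∉ N → #N ≤ D → P G₁ G₂ → ∃ N₁ N₂, N₁ ∪ N₂ = N ∧
        P (G₁ ⊔ starGraphOn u N₁) (G₂ ⊔ starGraphOn u N₂)) :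
    ∃ G₁ G₂, G ≤ G₁ ⊔ G₂ ∧ P G₁ G₂ := by
  have := Fintype.ofFinite U
  suffices ∀ S : Finset U, ∃ G₁ G₂ : SimpleGraph U,
      (∀ x y, G₁.Adj x y → x ∈ S ∧ y ∈ S) ∧ (∀ x y, G₂.Adj x y → x ∈ S ∧ y ∈ S) ∧
      (∀ x ∈ S, ∀ y ∈ S, G.Adj x y → G₁.Adj x y ∨ G₂.Adj x y) ∧ P G₁ G₂ by
    obtain ⟨G₁, G₂, _, _, h, hP⟩ := this univ
    exact ⟨G₁, G₂, fun x y hxy => h x (mem_univ x) y (mem_univ y) hxy, hP⟩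
  refine hG.induction ⟨⊥, ⊥, by simp, by simp, by simp, bot⟩ ?_
  rintro S u huS hle ⟨G₁, G₂, s₁, s₂, hcov, hP⟩
  have huN : u ∉ ({w ∈ S | G.Adj u w} : Finset U) := by simp
  obtain ⟨N₁, N₂, hN, hP'⟩ := step G₁ G₂ u _ (fun y h => huS (s₁ _ _ h).1)
    (fun y h => huS (s₂ _ _ h).1) huN hle hP
  have star_mem : ∀ N : Finset U, N ⊆ N₁ ∪ N₂ → ∀ x y, (starGraphOn u N).Adj x y →
      x ∈ insert u S ∧ y ∈ insert u S := by
    intro N hN' x y h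
    rw [hN] at hN'
    rw [starGraphOn, fromRel_adj] at h
    obtain ⟨_, h⟩ := h
    rcases h with ⟨rfl, h⟩ | ⟨rfl, h⟩
    · exact ⟨mem_insert_self _ _, mem_insert_of_mem (mem_filter.1 (hN' h)).1⟩
    · exact ⟨mem_insert_of_mem (mem_filter.1 (hN' h)).1, mem_insert_self _ _⟩
  have mem : ∀ y ∈ S, G.Adj u y → (starGraphOn u N₁).Adj u y ∨ (starGraphOn u N₂).Adj u y := by
    intro y hy h
    have hmem : y ∈ N₁ ∪ N₂ := by rw [hN]; simp [hy, h]
    rw [starGraphOn_adj_left fun h => huN (hN ▸ mem_union_left _ h),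
      starGraphOn_adj_left fun h => huN (hN ▸ mem_union_right _ h)]
    exact mem_union.1 hmem
  refine ⟨_, _, ?_, ?_, ?_, hP'⟩
  · rintro x y (h | h)
    · exact ⟨mem_insert_of_mem (s₁ _ _ h).1, mem_insert_of_mem (s₁ _ _ h).2⟩
    · exact star_mem _ subset_union_left _ _ h
  · rintro x y (h | h)
    · exact ⟨mem_insert_of_mem (s₂ _ _ h).1, mem_insert_of_mem (s₂ _ _ h).2⟩
    · exact star_mem _ subset_union_right _ _ h
  · intro x hx y hy hxy
    rcases mem_insert.1 hx with rfl | hx'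
    · rcases mem_insert.1 hy with rfl | hy'
      · exact absurd rfl hxy.ne
      · exact (mem y hy' hxy).imp .inr .inr
    · rcases mem_insert.1 hy with rfl | hy'
      · exact (mem x hx' hxy.symm).imp (fun h => .inr h.symm) (fun h => .inr h.symm)
      · exact (hcov x hx' y hy' hxy).imp .inl .inl

/-- A `2t`-degenerate graph is the union of two `t`-degenerate graphs. -/
theorem IsDegenerate.exists_degenerate_degenerate [Finite U] {G : SimpleGraph U} {t : ℕ}
    (hG : IsDegenerate (2 * t) G) :
    ∃ G₁ G₂, G ≤ G₁ ⊔ G₂ ∧ IsDegenerate t G₁ ∧ IsDegenerate t G₂ := by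
  refine hG.exists_decomposition ⟨isDegenerate_bot t, isDegenerate_bot t⟩ ?_
  rintro G₁ G₂ u N h₁ h₂ huN hN ⟨d₁, d₂⟩
  obtain ⟨N₁, hN₁, hc⟩ := exists_subset_card_eq (show #N - t ≤ #N by omega)
  refine ⟨N₁, N \ N₁, union_sdiff_of_subset hN₁, ?_, ?_⟩
  · exact d₁.sup_star h₁ (fun h => huN (hN₁ h)) (by omega)
  · exact d₂.sup_star h₂ (fun h => huN (mem_sdiff.1 h).1) (by rw [card_sdiff_of_subset hN₁]; omega)

/-- An `a`-degenerate graph is the union of a `K_a`-free graph and a `1`-degenerate graph. -/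
theorem IsDegenerate.exists_cliqueFree_degenerate [Finite U] {G : SimpleGraph U} {a : ℕ}
    (ha : 3 ≤ a) (hG : IsDegenerate a G) :
    ∃ G₁ G₂, G ≤ G₁ ⊔ G₂ ∧ G₁.CliqueFree a ∧ IsDegenerate 1 G₂ := by
  refine hG.exists_decomposition
    (P := fun G₁ G₂ => G₁.CliqueFree a ∧ IsDegenerate 1 G₂)
    ⟨cliqueFree_bot (by omega), isDegenerate_bot 1⟩ ?_
  rintro G₁ G₂ u N h₁ h₂ huN hN ⟨d₁, d₂⟩
  -- A new `K_a` contains `u` and has its other `a - 1` vertices in `N₁`, so they fill `N₁`. It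
  -- therefore suffices to find one back edge whose transfer to `G₂` leaves no clique behind.
  have key : ∀ N₁ : Finset U, u ∉ N₁ → #N₁ ≤ a - 1 → ¬ G₁.IsNClique (a - 1) N₁ →
      (G₁ ⊔ starGraphOn u N₁).CliqueFree a := by
    intro N₁ huN₁ hN₁ hcl s hs
    have hsub : ∀ x ∈ s, x ≠ u → ∀ y ∈ s, y ≠ u → x ≠ y → G₁.Adj x y := by
      intro x hx hxu y hy hyu hxy
      exact (hs.1 hx hy hxy).resolve_right (not_starGraphOn_adj hxu hyu)
    by_cases hus : u ∈ s
    · have hss : s.erase u ⊆ N₁ := by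
        intro x hx
        have hadj := hs.1 hus (mem_erase.1 hx).2 (mem_erase.1 hx).1.symm
        exact (starGraphOn_adj_left huN₁).1 (hadj.resolve_left (h₁ x))
      have hcs : #(s.erase u) = a - 1 := by rw [card_erase_of_mem hus, hs.2]
      have heq := eq_of_subset_of_card_le hss (by omega)
      refine hcl ⟨?_, by rw [← heq, hcs]⟩
      rw [← heq]
      intro x hx y hy hxy
      have hx := mem_erase.1 hx
      have hy := mem_erase.1 hy
      exact hsub x hx.2 hx.1 y hy.2 hy.1 hxy
    · refine d₁ s ⟨fun x hx y hy hxy => ?_, hs.2⟩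
      exact hsub x hx (fun e => hus (e ▸ hx)) y hy (fun e => hus (e ▸ hy)) hxy
  by_cases hw : ∃ w ∈ N, ¬ G₁.IsNClique (a - 1) (N.erase w)
  · obtain ⟨w, hwN, hw⟩ := hw
    refine ⟨N.erase w, {w}, ?_, key _ (fun h => huN (mem_erase.1 h).2) ?_ hw,
      d₂.sup_star h₂ ?_ (by simp)⟩
    · rw [union_comm, ← insert_eq, insert_erase hwN]
    · rw [card_erase_of_mem hwN]; omega
    · rw [mem_singleton]; rintro rfl; exact huN hwN
  · push Not at hw
    rcases N.eq_empty_or_nonempty with rfl | ⟨w, hwN⟩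
    · refine ⟨∅, ∅, by simp, key ∅ (by simp) (by simp) ?_, d₂.sup_star h₂ (by simp) (by simp)⟩
      intro h
      have := h.2
      simp at this
      omega
    · have hc : #N = a := by
        have := (hw w hwN).2
        rw [card_erase_of_mem hwN] at this
        omega
      -- If every choice of `w` fails, then `N` is itself a `K_a` in `G₁`: as `a ≥ 3`, any two
      -- vertices of `N` survive the removal of some third one.
      refine absurd ⟨fun x hx y hy hxy => ?_, hc⟩ (d₁ N)
      obtain ⟨z, hz, hzx, hzy⟩ : ∃ z ∈ N, z ≠ x ∧ z ≠ y := by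
        have : 0 < #((N.erase x).erase y) := by
          rw [card_erase_of_mem (mem_erase.2 ⟨hxy.symm, hy⟩), card_erase_of_mem hx]; omega
        obtain ⟨z, hz⟩ := card_pos.1 this
        simp only [mem_erase] at hz
        exact ⟨z, hz.2.2, hz.2.1, hz.1⟩
      exact (hw z hz).1 (mem_coe.2 (mem_erase.2 ⟨hzx.symm, hx⟩)) (mem_coe.2 (mem_erase.2 ⟨hzy.symm, hy⟩)) hxy

/-- A `(2t+1)`-degenerate graph has a vertex bipartition both of whose parts induce
`t`-degenerate graphs. -/
theorem IsDegenerate.exists_bipartition [Finite U] {G : SimpleGraph U} {t : ℕ}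
    (hG : IsDegenerate (2 * t + 1) G) :
    ∃ G₁ G₂ : SimpleGraph U, G ≤ G₁ ⊔ G₂ ∧ IsDegenerate t G₁ ∧ G₂.Colorable 2 := by
  have := Fintype.ofFinite U
  obtain ⟨c, hc⟩ : ∃ c : U → Bool, ∀ T ⊆ (univ : Finset U), T.Nonempty →
      ∃ v ∈ T, #{w ∈ T | G.Adj v w ∧ c v = c w} ≤ t := by
    refine hG.induction (P := fun S => ∃ c : U → Bool, ∀ T ⊆ S, T.Nonempty →
      ∃ v ∈ T, #{w ∈ T | G.Adj v w ∧ c v = c w} ≤ t) ⟨fun _ => true, ?_⟩ ?_ univ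
    · intro T hT hne
      exact absurd (subset_empty.1 hT) hne.ne_empty
    · rintro S u huS hle ⟨c, hc⟩
      -- By pigeonhole, one of the two colours occurs at most `t` times among at most `2t + 1` back
      -- neighbours.
      obtain ⟨b, hb⟩ : ∃ b : Bool, #{w ∈ S | G.Adj u w ∧ b = c w} ≤ t := by
        by_contra! hcon
        have h1 := hcon true
        have h2 := hcon false
        have hd : Disjoint ({w ∈ S | G.Adj u w ∧ true = c w} : Finset U)
            {w ∈ S | G.Adj u w ∧ false = c w} := by
          rw [disjoint_filter]
          rintro x _ ⟨_, h⟩ ⟨_, h'⟩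
          simp [← h] at h'
        have h3 := card_union_of_disjoint hd
        have h4 : #({w ∈ S | G.Adj u w ∧ true = c w} ∪ {w ∈ S | G.Adj u w ∧ false = c w}) ≤
            #{w ∈ S | G.Adj u w} := by
          refine card_le_card fun x hx => ?_
          simp only [mem_union, mem_filter] at hx ⊢
          tauto
        omega
      refine ⟨Function.update c u b, fun T hT hne => ?_⟩
      by_cases huT : u ∈ T
      · refine ⟨u, huT, le_trans (card_le_card fun w hw => ?_) hb⟩
        simp only [mem_filter, Function.update_self] at hw ⊢
        have hwu : w ≠ u := hw.2.1.ne'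
        rw [Function.update_of_ne hwu] at hw
        exact ⟨(mem_insert.1 (hT hw.1)).resolve_left hwu, hw.2⟩
      · have hT' : T ⊆ S := fun x hx =>
          (mem_insert.1 (hT hx)).resolve_left fun e => huT (e ▸ hx)
        obtain ⟨v, hv, hle⟩ := hc T hT' hne
        refine ⟨v, hv, le_trans (card_le_card fun w hw => ?_) hle⟩
        simp only [mem_filter] at hw ⊢
        have hvu : v ≠ u := fun e => huT (e ▸ hv)
        have hwu : w ≠ u := fun e => huT (e ▸ hw.1)
        rwa [Function.update_of_ne hvu, Function.update_of_ne hwu] at hw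
  refine ⟨fromRel fun x y => G.Adj x y ∧ c x = c y, fromRel fun x y => G.Adj x y ∧ c x ≠ c y,
    ?_, ?_, ?_⟩
  · intro x y hxy
    rw [sup_adj, fromRel_adj, fromRel_adj]
    by_cases h : c x = c y
    · exact .inl ⟨hxy.ne, .inl ⟨hxy, h⟩⟩
    · exact .inr ⟨hxy.ne, .inl ⟨hxy, h⟩⟩
  · intro T hT
    obtain ⟨v, hv, hle⟩ := hc T (subset_univ T) hT
    refine ⟨v, hv, le_trans (card_le_card fun w hw => ?_) hle⟩
    simp only [mem_filter] at hw ⊢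
    rw [fromRel_adj] at hw
    rcases hw.2.2 with h | h
    · exact ⟨hw.1, h⟩
    · exact ⟨hw.1, h.1.symm, h.2.symm⟩
  · have C : (fromRel fun x y => G.Adj x y ∧ c x ≠ c y).Coloring Bool :=
      Coloring.mk c fun {x y} h => by
        rw [fromRel_adj] at h
        rcases h.2 with h | h
        · exact h.2
        · exact h.2.symm
    simpa using C.colorable

/-- A `4`-degenerate graph is the union of two triangle-free graphs. -/
theorem IsDegenerate.exists_cliqueFree_cliqueFree [Finite U] {G : SimpleGraph U}
    (hG : IsDegenerate 4 G) :
    ∃ G₁ G₂ : SimpleGraph U, G ≤ G₁ ⊔ G₂ ∧ G₁.CliqueFree 3 ∧ G₂.CliqueFree 3 := by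
  have := Fintype.ofFinite U
  obtain ⟨c, hc⟩ : ∃ c : U → Fin 5, ∀ x ∈ (univ : Finset U), ∀ y ∈ (univ : Finset U),
      G.Adj x y → c x ≠ c y := by
    refine hG.induction (P := fun S => ∃ c : U → Fin 5, ∀ x ∈ S, ∀ y ∈ S, G.Adj x y → c x ≠ c y)
      ⟨fun _ => 0, by simp⟩ ?_ univ
    rintro S u huS hle ⟨c, hc⟩
    obtain ⟨b, hb⟩ : ∃ b : Fin 5, b ∉ ({w ∈ S | G.Adj u w} : Finset U).image c := by
      by_contra! hcon
      have := card_le_card (fun b _ => hcon b : (univ : Finset (Fin 5)) ⊆ _)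
      rw [card_univ, Fintype.card_fin] at this
      have := this.trans (card_image_le.trans hle)
      omega
    have hb' : ∀ y ∈ S, G.Adj u y → b ≠ c y := fun y hy hadj e =>
      hb (mem_image.2 ⟨y, mem_filter.2 ⟨hy, hadj⟩, e.symm⟩)
    refine ⟨Function.update c u b, fun x hx y hy hxy => ?_⟩
    rcases mem_insert.1 hx with rfl | hx'
    · rcases mem_insert.1 hy with rfl | hy'
      · exact absurd rfl hxy.ne
      · rw [Function.update_self, Function.update_of_ne hxy.ne']
        exact hb' y hy' hxy
    · rcases mem_insert.1 hy with rfl | hy'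
      · rw [Function.update_self, Function.update_of_ne hxy.ne]
        exact (hb' x hx' hxy.symm).symm
      · have hxu : x ≠ u := fun e => huS (e ▸ hx')
        have hyu : y ≠ u := fun e => huS (e ▸ hy')
        rw [Function.update_of_ne hxu, Function.update_of_ne hyu]
        exact hc x hx' y hy' hxy
  have free : ∀ s : Fin 5, (∀ a b d : Fin 5, (a = b + s ∨ b = a + s) → (a = d + s ∨ d = a + s) →
      (b = d + s ∨ d = b + s) → False) →
      (fromRel fun x y => c x = c y + s).CliqueFree 3 := by
    intro s hs T hT
    obtain ⟨x, y, z, hxy, hxz, hyz, _⟩ := is3Clique_iff.1 hT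
    rw [fromRel_adj] at hxy hxz hyz
    exact hs _ _ _ hxy.2 hxz.2 hyz.2
  -- `K₅` on the colours is the union of two 5-cycles, with differences `±1` and `±2`; a graph that
  -- maps to a 5-cycle has no triangle.
  refine ⟨fromRel fun x y => c x = c y + 1, fromRel fun x y => c x = c y + 2, ?_,
    free 1 (by decide), free 2 (by decide)⟩
  intro x y hxy
  have hne := hc x (mem_univ x) y (mem_univ y) hxy
  rw [sup_adj, fromRel_adj, fromRel_adj]
  have : ∀ a b : Fin 5, a ≠ b → (a = b + 1 ∨ b = a + 1) ∨ (a = b + 2 ∨ b = a + 2) := by decide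
  exact (this _ _ hne).imp (fun h => ⟨hxy.ne, h⟩) (fun h => ⟨hxy.ne, h⟩)

end Degenerate

end SimpleGraph

namespace SimpleGraph

/-! ### Strictly 2-balanced graphs: edge counts and minimum degree. -/

section Balanced

variable {V W : Type*} {H : SimpleGraph V} {K : SimpleGraph W}

theorem twoDensity_congr (e : H ≃g K) : H.twoDensity = K.twoDensity := by
  unfold twoDensity
  rw [numEdges_congr e, numVerts_congr e]

theorem twoDensity_le_maxTwoDensity [Finite V] (J : H.Subgraph) :
    J.coe.twoDensity ≤ H.maxTwoDensity :=
  le_ciSup (f := fun J : H.Subgraph => J.coe.twoDensity) (Set.finite_range _).bddAbove J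

theorem asymTwoDensity_le_maxAsymTwoDensity [Finite V] (J : H.Subgraph) :
    J.coe.asymTwoDensity K ≤ H.maxAsymTwoDensity K :=
  le_ciSup (f := fun J : H.Subgraph => J.coe.asymTwoDensity K) (Set.finite_range _).bddAbove J

theorem of_one_lt_twoDensity (h : 1 < H.twoDensity) :
    3 ≤ H.numVerts ∧ 1 ≤ H.numEdges ∧
      (H.numEdges : ℝ) = H.twoDensity * (H.numVerts - 2) + 1 := by
  have h' : H.twoDensity = H.twoDensity := rfl
  conv_rhs at h' => unfold twoDensity
  split_ifs at h' with h1 h2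
  · refine ⟨h1.2, h1.1, ?_⟩
    have : (3 : ℝ) ≤ H.numVerts := by exact_mod_cast h1.2
    rw [h', div_mul_cancel₀ _ (by linarith)]
    ring
  · rw [h'] at h; norm_num at h
  · rw [h'] at h; norm_num at h

theorem IsStrictlyTwoBalanced.maxTwoDensity_eq [Finite V] (hH : H.IsStrictlyTwoBalanced) :
    H.maxTwoDensity = H.twoDensity := by
  obtain ⟨J, hJ⟩ := exists_eq_ciSup_of_finite (f := fun J : H.Subgraph => J.coe.twoDensity)
  have : J = ⊤ := by
    by_contra hne
    exact (hH J (lt_top_iff_ne_top.2 hne)).ne hJ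
  subst this
  rw [← twoDensity_congr Subgraph.topIso]
  exact hJ.symm

theorem IsStrictlyTwoBalanced.numEdges_eq [Finite V] (hH : H.IsStrictlyTwoBalanced)
    (h : 1 < H.maxTwoDensity) :
    3 ≤ H.numVerts ∧ (H.numEdges : ℝ) = H.maxTwoDensity * (H.numVerts - 2) + 1 := by
  rw [hH.maxTwoDensity_eq] at h ⊢
  have := of_one_lt_twoDensity h
  exact ⟨this.1, this.2.2⟩

theorem IsStrictlyTwoBalanced.numVerts_le_numEdges [Finite V] (hH : H.IsStrictlyTwoBalanced)
    (h : 1 < H.maxTwoDensity) : H.numVerts ≤ H.numEdges := by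
  obtain ⟨hv, he⟩ := hH.numEdges_eq h
  have hv' : (3 : ℝ) ≤ H.numVerts := by exact_mod_cast hv
  have : (H.numVerts : ℝ) < H.numEdges + 1 := by nlinarith
  have : H.numVerts < H.numEdges + 1 := by exact_mod_cast this
  omega

theorem exists_subgraph_delete_vertex [Finite V] (H : SimpleGraph V) (x : V) :
    ∃ J : H.Subgraph, J < ⊤ ∧ J.coe.numVerts + 1 = H.numVerts ∧
      J.coe.numEdges + (H.neighborSet x).ncard = H.numEdges := by
  have := Fintype.ofFinite V
  refine ⟨(⊤ : H.Subgraph).deleteVerts {x}, ?_, ?_, ?_⟩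
  · refine lt_top_iff_ne_top.2 fun h => ?_
    have : x ∈ ((⊤ : H.Subgraph).deleteVerts {x}).verts := by rw [h]; trivial
    simp at this
  · rw [numVerts_coe, Subgraph.deleteVerts_verts, numVerts, ← Set.ncard_univ]
    exact Set.ncard_sdiff_singleton_add_one (Set.mem_univ x)
  · rw [numEdges_coe]
    have h1 : ((⊤ : H.Subgraph).deleteVerts {x}).edgeSet = H.edgeSet \ H.incidenceSet x := by
      ext e
      induction e with
      | _ a b =>
        simp only [Subgraph.mem_edgeSet, Subgraph.deleteVerts_adj, Subgraph.verts_top,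
          Set.mem_univ, Set.mem_singleton_iff, Subgraph.top_adj, Set.mem_sdiff, mem_edgeSet,
          mk'_mem_incidenceSet_iff]
        grind
    have h2 : (H.incidenceSet x).ncard = (H.neighborSet x).ncard := by
      rw [← Nat.card_coe_set_eq, ← Nat.card_coe_set_eq]
      exact Nat.card_congr (H.incidenceSetEquivNeighborSet x)
    rw [h1, ← h2, Set.ncard_sdiff_add_ncard_of_subset (H.incidenceSet_subset x)]
    rfl

/-- Deleting a vertex of degree at most `m₂` would not lower the 2-density. Four vertices are
required so that three remain and the main clause of `twoDensity` applies. -/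
theorem IsStrictlyTwoBalanced.lt_degree [Finite V] (hH : H.IsStrictlyTwoBalanced)
    (h : 1 < H.maxTwoDensity) (hv : 4 ≤ H.numVerts) (x : V) :
    H.maxTwoDensity < (H.neighborSet x).ncard := by
  obtain ⟨J, hJ, hJv, hJe⟩ := exists_subgraph_delete_vertex H x
  obtain ⟨_, he⟩ := hH.numEdges_eq h
  have hd := hH J hJ
  have hJv' : (J.coe.numVerts : ℝ) + 1 = H.numVerts := by exact_mod_cast hJv
  have hJe' : (J.coe.numEdges : ℝ) + (H.neighborSet x).ncard = H.numEdges := by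
    exact_mod_cast hJe
  have hv' : (4 : ℝ) ≤ H.numVerts := by exact_mod_cast hv
  by_contra! hcon
  have he' : H.maxTwoDensity * (J.coe.numVerts - 2) + 1 ≤ J.coe.numEdges := by
    have : (J.coe.numVerts : ℝ) = H.numVerts - 1 := by linarith
    rw [this]
    linarith
  have h1 : (1 : ℝ) ≤ J.coe.numEdges := by nlinarith
  have h1' : 1 ≤ J.coe.numEdges := by exact_mod_cast h1
  unfold twoDensity at hd
  rw [if_pos ⟨h1', by omega⟩, div_lt_iff₀ (by linarith)] at hd
  linarith

theorem eq_top_of_three [Finite V] (hv : H.numVerts = 3) (he : H.numEdges = 3) : H = ⊤ := by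
  have := Fintype.ofFinite V
  have h1 : #H.edgeFinset = #(⊤ : SimpleGraph V).edgeFinset := by
    rw [← numEdges_eq_card, he, card_edgeFinset_top_eq_card_choose_two,
      ← Nat.card_eq_fintype_card]
    change 3 = H.numVerts.choose 2
    rw [hv]
    rfl
  exact edgeFinset_inj.1 (eq_of_subset_of_card_le (edgeFinset_mono le_top) h1.ge)

theorem IsStrictlyTwoBalanced.eq_top [Finite V] (hH : H.IsStrictlyTwoBalanced)
    (h : 1 < H.maxTwoDensity) (hv : H.numVerts = 3) : H = ⊤ ∧ H.numEdges = 3 ∧ H.maxTwoDensity = 2 := by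
  obtain ⟨_, he⟩ := hH.numEdges_eq h
  have h2 := two_mul_numEdges_le (G := H)
  rw [hv] at he h2
  have h3 : H.numEdges = 3 := by
    have : (2 : ℝ) < H.numEdges := by rw [he]; push_cast; linarith
    have : 2 < H.numEdges := by exact_mod_cast this
    omega
  refine ⟨eq_top_of_three hv h3, h3, ?_⟩
  rw [h3] at he
  push_cast at he
  linarith

theorem IsStrictlyTwoBalanced.one_lt_degree [Finite V] (hH : H.IsStrictlyTwoBalanced)
    (h : 1 < H.maxTwoDensity) (x : V) : 1 < (H.neighborSet x).ncard := by
  have := Fintype.ofFinite V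
  rcases (hH.numEdges_eq h).1.eq_or_lt with hv | hv
  · obtain ⟨rfl, _⟩ := hH.eq_top h hv.symm
    have : Fintype.card V = 3 := by rw [← Nat.card_eq_fintype_card]; exact hv.symm
    rw [← Nat.card_coe_set_eq, Nat.card_eq_fintype_card, card_neighborSet_eq_degree]
    simp [this]
  · have := h.trans (hH.lt_degree h hv x)
    exact_mod_cast this

theorem IsAcyclic.numEdges_lt [Finite V] [Nonempty V] (h : H.IsAcyclic) :
    H.numEdges < H.numVerts := by
  have := Fintype.ofFinite V
  obtain ⟨T, hT, _, htree⟩ := connected_top.exists_isTree_le_of_le_of_isAcyclic le_top h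
  have h1 := htree.card_edgeFinset
  have h2 : H.numEdges ≤ T.numEdges := Set.ncard_le_ncard (edgeSet_mono (by assumption))
  rw [numEdges_eq_card (G := T)] at h2
  rw [numVerts, Nat.card_eq_fintype_card]
  omega

theorem numEdges_cycleGraph {n : ℕ} (hn : 3 ≤ n) : (cycleGraph n).numEdges = n := by
  obtain ⟨k, rfl⟩ : ∃ k, n = k + 3 := ⟨n - 3, by omega⟩
  have h := (cycleGraph (k + 3)).sum_degrees_eq_twice_card_edges
  have h' : (cycleGraph (k + 3)).numEdges = #(cycleGraph (k + 3)).edgeFinset := by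
    rw [numEdges_eq_card]
    congr!
  have hd : ∀ v, (cycleGraph (k + 3)).degree v = 2 := fun v => by
    rw [← cycleGraph_degree_three_le (v := v)]
  simp only [hd] at h
  rw [sum_const, card_univ, Fintype.card_fin, smul_eq_mul] at h
  rw [h']
  omega

/-- If `e = v`, there is a cycle `C_n` in `H`. As `(n-1)/(n-2)` decreases in `n`, its 2-density is
at least that of `H`, so strict balancedness forces `H = C_n`. -/
theorem IsStrictlyTwoBalanced.numVerts_lt_numEdges [Finite V] (hH : H.IsStrictlyTwoBalanced)
    (h : 1 < H.maxTwoDensity) (hc : ¬ H.IsCycleGraph) : H.numVerts < H.numEdges := by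
  refine (hH.numVerts_le_numEdges h).lt_of_ne fun heq => hc ?_
  obtain ⟨hv, he⟩ := hH.numEdges_eq h
  have : Nonempty V := (Nat.card_pos_iff.1 (show 0 < H.numVerts by omega)).1
  have hna : ¬ H.IsAcyclic := fun ha => by
    have := ha.numEdges_lt
    omega
  rw [isAcyclic_iff_free_cycleGraph] at hna
  push Not at hna
  obtain ⟨n, hn, hf⟩ := hna
  obtain ⟨f⟩ := hf
  refine ⟨n, hn, ?_⟩
  by_cases htop : f.toSubgraph = ⊤
  · have e := f.isoToSubgraph
    rw [htop] at e
    exact ⟨(e.trans Subgraph.topIso).symm⟩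
  · have hlt := hH _ (lt_top_iff_ne_top.2 htop)
    have hvn : (cycleGraph n).numVerts = n := by simp [numVerts]
    have hle : n ≤ H.numVerts := by
      rw [← hvn]
      exact Nat.card_le_card_of_injective f f.injective
    rw [← twoDensity_congr f.isoToSubgraph, twoDensity, numEdges_cycleGraph hn, hvn,
      if_pos ⟨by omega, hn⟩] at hlt
    have hn' : (3 : ℝ) ≤ n := by exact_mod_cast hn
    have hle' : (n : ℝ) ≤ H.numVerts := by exact_mod_cast hle
    rw [div_lt_iff₀ (by linarith)] at hlt
    rw [← heq] at he
    nlinarith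

theorem four_mul_numEdges_le [Finite V] (h : H.Colorable 2) :
    4 * H.numEdges ≤ H.numVerts ^ 2 := by
  have := IsBipartite.four_mul_encard_edgeSet_le (G := H) h
  rw [ENat.card_eq_coe_natCard, ← (Set.toFinite H.edgeSet).cast_ncard_eq] at this
  exact_mod_cast this

end Balanced

/-! ### The asymmetric 2-density and graphs balanced with respect to it. -/

section AsymBalanced

variable {V W : Type*} [Finite V] [Finite W] {H₁ : SimpleGraph V} {H₂ : SimpleGraph W}

-- With `m` the common 2-density, `e(J) ≤ m (v(J) - 2) + 1 = m (v(J) - 2 + 1/m)` for the relevant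
-- subgraphs `J`.
omit [Finite W] in
theorem maxAsymTwoDensity_le_of_eq (h : H₁.maxTwoDensity = H₂.maxTwoDensity)
    (h1 : 1 < H₂.maxTwoDensity) : H₁.maxAsymTwoDensity H₂ ≤ H₂.maxTwoDensity := by
  refine ciSup_le fun J => ?_
  unfold asymTwoDensity
  set m := H₂.maxTwoDensity
  split_ifs with hc
  · have hv : (2 : ℝ) ≤ J.coe.numVerts := by exact_mod_cast hc.2
    have hm : 0 < 1 / m := by positivity
    rw [div_le_iff₀ (by linarith), mul_add, mul_one_div_cancel (by linarith)]
    have hd := twoDensity_le_maxTwoDensity J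
    rw [h] at hd
    unfold twoDensity at hd
    split_ifs at hd with h2 h3
    · have : (3 : ℝ) ≤ J.coe.numVerts := by exact_mod_cast h2.2
      rw [div_le_iff₀ (by linarith)] at hd
      linarith
    · have := two_mul_numEdges_le (G := J.coe)
      rw [h3.2] at this ⊢
      have : (J.coe.numEdges : ℝ) ≤ 1 := by exact_mod_cast (by omega : J.coe.numEdges ≤ 1)
      push_cast
      linarith
    · have : J.coe.numEdges = 0 := by omega
      rw [this]
      push_cast
      nlinarith
  · linarith

omit [Finite W] in
theorem maxTwoDensity_lt_maxAsymTwoDensity (h : H₂.maxTwoDensity < H₁.maxTwoDensity)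
    (h1 : 1 < H₂.maxTwoDensity) (he : 1 ≤ H₂.numEdges) :
    H₂.maxTwoDensity < H₁.maxAsymTwoDensity H₂ := by
  obtain ⟨J, hJ⟩ := exists_lt_of_lt_ciSup (f := fun J : H₁.Subgraph => J.coe.twoDensity) h
  refine lt_of_lt_of_le ?_ (asymTwoDensity_le_maxAsymTwoDensity J)
  obtain ⟨hv, _, hJe⟩ := of_one_lt_twoDensity (h1.trans hJ)
  have hv' : (3 : ℝ) ≤ J.coe.numVerts := by exact_mod_cast hv
  unfold asymTwoDensity
  have hm : 0 < 1 / H₂.maxTwoDensity := by positivity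
  rw [if_pos ⟨he, by omega⟩, lt_div_iff₀ (by linarith), mul_add,
    mul_one_div_cancel (by linarith), hJe]
  have := mul_lt_mul_of_pos_right hJ (by linarith : (0 : ℝ) < J.coe.numVerts - 2)
  linarith

omit [Finite W] in
theorem IsStrictlyBalancedWrt.maxAsymTwoDensity_eq (hH : H₁.IsStrictlyBalancedWrt H₂) :
    H₁.maxAsymTwoDensity H₂ = H₁.asymTwoDensity H₂ := by
  obtain ⟨J, hJ⟩ := exists_eq_ciSup_of_finite
    (f := fun J : H₁.Subgraph => J.coe.asymTwoDensity H₂)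
  have : J = ⊤ := by
    by_contra hne
    exact (hH J (lt_top_iff_ne_top.2 hne)).ne hJ
  subst this
  refine hJ.symm.trans ?_
  unfold asymTwoDensity
  rw [numVerts_coe_top, numEdges_coe_top]

omit [Finite W] in
theorem IsStrictlyBalancedWrt.numEdges_eq (hH : H₁.IsStrictlyBalancedWrt H₂)
    (h1 : 1 < H₂.maxTwoDensity) (h : H₂.maxTwoDensity < H₁.maxAsymTwoDensity H₂) :
    3 ≤ H₁.numVerts ∧ 1 ≤ H₂.numEdges ∧ (H₁.numEdges : ℝ) =
      H₁.maxAsymTwoDensity H₂ * (H₁.numVerts - 2 + 1 / H₂.maxTwoDensity) := by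
  have hm : 0 < 1 / H₂.maxTwoDensity := by positivity
  have heq := hH.maxAsymTwoDensity_eq
  unfold asymTwoDensity at heq
  split_ifs at heq with hc
  · have hv : (2 : ℝ) ≤ H₁.numVerts := by exact_mod_cast hc.2
    have he : (H₁.numEdges : ℝ) =
        H₁.maxAsymTwoDensity H₂ * (H₁.numVerts - 2 + 1 / H₂.maxTwoDensity) := by
      rw [heq, div_mul_cancel₀ _ (by linarith)]
    refine ⟨?_, hc.1, he⟩
    -- On two vertices the asymmetric density is at most `m₂(H₂)`, the value for a single edge.
    by_contra hv3
    have hv2 : H₁.numVerts = 2 := by omega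
    have h2 := two_mul_numEdges_le (G := H₁)
    rw [hv2] at h2 he
    have h3 : (H₁.numEdges : ℝ) ≤ 1 := by exact_mod_cast (by omega : H₁.numEdges ≤ 1)
    push_cast at he
    rw [sub_self, zero_add, mul_one_div] at he
    rw [he, div_le_one (by linarith)] at h3
    linarith
  · linarith

theorem IsStrictlyBalancedWrt.lt_degree (hH : H₁.IsStrictlyBalancedWrt H₂)
    (h1 : 1 < H₂.maxTwoDensity) (h : H₂.maxTwoDensity < H₁.maxAsymTwoDensity H₂) (x : V) :
    H₁.maxAsymTwoDensity H₂ < (H₁.neighborSet x).ncard := by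
  obtain ⟨hv, he2, he⟩ := hH.numEdges_eq h1 h
  obtain ⟨J, hJ, hJv, hJe⟩ := exists_subgraph_delete_vertex H₁ x
  have hd := hH J hJ
  have hm : 0 < 1 / H₂.maxTwoDensity := by positivity
  have hJv' : (J.coe.numVerts : ℝ) = H₁.numVerts - 1 := by
    rw [← hJv]; push_cast; ring
  have hJe' : (J.coe.numEdges : ℝ) + (H₁.neighborSet x).ncard = H₁.numEdges := by
    exact_mod_cast hJe
  have hv' : (3 : ℝ) ≤ H₁.numVerts := by exact_mod_cast hv
  unfold asymTwoDensity at hd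
  rw [if_pos ⟨he2, by omega⟩, div_lt_iff₀ (by linarith), hJv'] at hd
  linarith

end AsymBalanced

/-! ### Colourings obtained from the decompositions. -/

section Decompositions

variable {U V W : Type*} [Finite U] [Finite V] [Finite W]
  {G : SimpleGraph U} {H₁ : SimpleGraph V} {H₂ : SimpleGraph W}

omit [Finite U] [Finite V] [Finite W] in
theorem Arrows.symm (h : G.Arrows H₁ H₂) : G.Arrows H₂ H₁ := by
  by_contra hc
  unfold Arrows at hc
  push Not at hc
  obtain ⟨c, hc₂, hc₁⟩ := hc
  refine not_arrows_of_le_sup (G₁ := c.labelGraph 1) (G₂ := c.labelGraph 0) ?_ ?_ ?_ h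
  · intro x y hxy
    rw [sup_adj, EdgeLabeling.labelGraph_adj, EdgeLabeling.labelGraph_adj]
    generalize hz : c ⟨s(x, y), hxy⟩ = z
    fin_cases z
    · exact .inr ⟨hxy, hz⟩
    · exact .inl ⟨hxy, hz⟩
  · exact not_nonempty_iff.2 hc₁
  · exact not_nonempty_iff.2 hc₂

omit [Finite U] [Finite W] in
theorem not_isContained_of_colorable {K : SimpleGraph U} (hK : K.Colorable 2)
    (hH : ¬ H₂.Colorable 2) : ¬ H₂ ⊑ K := fun ⟨f⟩ => hH (hK.of_hom f.toHom)

-- `G` is `(2⌊m⌋ + 1)`-degenerate. The edges inside the classes of a suitable bipartition form a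
-- `⌊m⌋`-degenerate graph, too sparse for `H₁`; the crossing edges form a bipartite graph.
omit [Finite W] in
theorem not_arrows_of_not_colorable [Nonempty V] {m : ℝ} (hm : 0 ≤ m) (hG : G.maxDensity ≤ m)
    (hdeg : ∀ x, m < (H₁.neighborSet x).ncard) (hH : ¬ H₂.Colorable 2) : ¬ G.Arrows H₁ H₂ := by
  have hk := Nat.floor_le hm
  have hk' := Nat.lt_floor_add_one m
  obtain ⟨G₁, G₂, hle, h₁, h₂⟩ := (isDegenerate_of_maxDensity (G := G) (D := 2 * ⌊m⌋₊ + 1)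
    (by push_cast; linarith)).exists_bipartition
  exact not_arrows_of_le_sup hle
    (h₁.not_isContained fun x => by exact_mod_cast hk.trans_lt (hdeg x))
    (not_isContained_of_colorable h₂ hH)

theorem not_colorable_of_three (hv : H₂.numVerts = 3) (he : H₂.numEdges = 3) :
    ¬ H₂.Colorable 2 := by
  intro hc
  have := four_mul_numEdges_le hc
  rw [hv, he] at this
  norm_num at this

omit [Finite U] in
theorem not_isContained_of_eq_top {K : SimpleGraph U} (hK : K.CliqueFree 3)
    (hv : H₂.numVerts = 3) (h : H₂ = ⊤) : ¬ H₂ ⊑ K := by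
  intro hc
  have e : Fin 3 ≃ W := (Finite.equivFinOfCardEq hv).symm
  subst h
  exact (not_cliqueFree_iff_top_isContained 3).2
    (IsContained.trans ⟨(Iso.completeGraph e).toCopy⟩ hc) hK

/-- The case of two bipartite strictly balanced graphs of equal `2`-density. -/
theorem not_arrows_of_colorable {m : ℝ} (h1 : 1 < m) (hG : G.maxDensity ≤ m)
    (hv₁ : 4 ≤ H₁.numVerts) (hv₂ : 4 ≤ H₂.numVerts)
    (he₁ : (H₁.numEdges : ℝ) = m * (H₁.numVerts - 2) + 1)
    (he₂ : (H₂.numEdges : ℝ) = m * (H₂.numVerts - 2) + 1)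
    (hd₁ : ∀ x, m < (H₁.neighborSet x).ncard) (hd₂ : ∀ x, m < (H₂.neighborSet x).ncard)
    (hc₁ : H₁.Colorable 2) (hc₂ : H₂.Colorable 2) : ¬ G.Arrows H₁ H₂ := by
  have := Fintype.ofFinite U
  have : Nonempty V := (Nat.card_pos_iff.1 (show 0 < H₁.numVerts by omega)).1
  have : Nonempty W := (Nat.card_pos_iff.1 (show 0 < H₂.numVerts by omega)).1
  have hk := Nat.floor_le (zero_le_one.trans h1.le)
  have hk' := Nat.lt_floor_add_one m
  have hk1 : 1 ≤ ⌊m⌋₊ := Nat.le_floor (by exact_mod_cast h1.le)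
  set k := ⌊m⌋₊
  have hk1' : (1 : ℝ) ≤ k := by exact_mod_cast hk1
  -- The bound `4e ≤ v²` gives `4m(v-2) ≤ (v-2)(v+2)`.
  have bip : ∀ e v : ℕ, 4 ≤ v → (e : ℝ) = m * (v - 2) + 1 → 4 * e ≤ v ^ 2 →
      1 ≤ e ∧ 4 * m ≤ v + 2 := by
    intro e v hv he h4
    have hv' : (4 : ℝ) ≤ v := by exact_mod_cast hv
    have h4' : (4 * e : ℝ) ≤ v ^ 2 := by exact_mod_cast h4
    constructor
    · have : (1 : ℝ) ≤ e := by nlinarith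
      exact_mod_cast this
    · refine le_of_mul_le_mul_right (a := (v : ℝ) - 2) ?_ (by linarith)
      nlinarith
  obtain ⟨p₁, b₁⟩ := bip _ _ hv₁ he₁ (four_mul_numEdges_le hc₁)
  obtain ⟨p₂, b₂⟩ := bip _ _ hv₂ he₂ (four_mul_numEdges_le hc₂)
  have hv₁' : (4 : ℝ) ≤ H₁.numVerts := by exact_mod_cast hv₁
  have hv₂' : (4 : ℝ) ≤ H₂.numVerts := by exact_mod_cast hv₂
  -- Below `k + 1/2`, `G` is `2k`-degenerate; at `k + 1/2`, two forest-type bounds fit exactly;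
  -- above it, `e(H₁) > k v(H₁)` and `e(H₂) > v(H₂)`, so pseudoforest-type bounds suffice.
  rcases lt_trichotomy m (k + 1 / 2) with h | h | h
  · obtain ⟨G₁, G₂, hle, h₁, h₂⟩ := (isDegenerate_of_maxDensity (G := G) (D := 2 * k)
      (by push_cast; linarith)).exists_degenerate_degenerate
    exact not_arrows_of_le_sup hle
      (h₁.not_isContained fun x => by exact_mod_cast hk.trans_lt (hd₁ x))
      (h₂.not_isContained fun x => by exact_mod_cast hk.trans_lt (hd₂ x))
  · obtain ⟨G₁, G₂, hle, h₁, h₂⟩ := exists_isSparse_self_self (G := G) (k₁ := k) (k₂ := 1)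
      (by push_cast; linarith)
    refine not_arrows_of_le_sup hle (h₁.not_isContained_self (by positivity) p₁ ?_)
      (h₂.not_isContained_self (by positivity) p₂ ?_)
    · have : (k * H₁.numVerts - k : ℝ) < H₁.numEdges := by
        rw [he₁, h]; linarith
      exact_mod_cast this
    · have : (1 * H₂.numVerts - 1 : ℝ) < H₂.numEdges := by
        rw [he₂]; nlinarith
      exact_mod_cast this
  · obtain ⟨G₁, G₂, hle, h₁, h₂⟩ := exists_isSparse_zero_zero (G := G) (k₁ := k) (k₂ := 1)
      (by push_cast; linarith)
    refine not_arrows_of_le_sup hle (h₁.not_isContained_self (by positivity) p₁ ?_)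
      (h₂.not_isContained_self (by positivity) p₂ ?_)
    · have : (k * H₁.numVerts - 0 : ℝ) < H₁.numEdges := by
        rw [he₁]
        have a1 : (m - k) * (4 * m - 2) ≤ (m - k) * H₁.numVerts :=
          mul_le_mul_of_nonneg_left (by linarith) (by linarith)
        have a2 : 0 < (2 * (m - k) - 1) * (2 * m - 1) := mul_pos (by linarith) (by linarith)
        linarith
      exact_mod_cast this
    · have : (1 * H₂.numVerts - 0 : ℝ) < H₂.numEdges := by
        rw [he₂]
        have : (1 / 2 : ℝ) * 2 < (m - 1) * (H₂.numVerts - 2) :=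
          mul_lt_mul'' (by linarith) (by linarith) (by norm_num) (by norm_num)
        linarith
      exact_mod_cast this

theorem not_arrows_of_maxTwoDensity_eq (h₁ : H₁.IsStrictlyTwoBalanced)
    (h₂ : H₂.IsStrictlyTwoBalanced) (heq : H₁.maxTwoDensity = H₂.maxTwoDensity)
    (h1 : 1 < H₂.maxTwoDensity) (hG : G.maxDensity ≤ H₂.maxTwoDensity) :
    ¬ G.Arrows H₁ H₂ := by
  have h1' : 1 < H₁.maxTwoDensity := heq ▸ h1
  obtain ⟨hv₁, he₁⟩ := h₁.numEdges_eq h1'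
  obtain ⟨hv₂, he₂⟩ := h₂.numEdges_eq h1
  have hd₁ := h₁.lt_degree h1'
  have hd₂ := h₂.lt_degree h1
  rw [heq] at he₁ hd₁
  have : Nonempty V := (Nat.card_pos_iff.1 (show 0 < H₁.numVerts by omega)).1
  have : Nonempty W := (Nat.card_pos_iff.1 (show 0 < H₂.numVerts by omega)).1
  have h0 : 0 ≤ H₂.maxTwoDensity := by linarith
  rcases hv₁.eq_or_lt with w₁ | w₁ <;> rcases hv₂.eq_or_lt with w₂ | w₂
  · obtain ⟨t₁, _⟩ := h₁.eq_top h1' w₁.symm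
    obtain ⟨t₂, _, hm⟩ := h₂.eq_top h1 w₂.symm
    obtain ⟨G₁, G₂, hle, f₁, f₂⟩ := (isDegenerate_of_maxDensity (G := G) (D := 4)
      (by push_cast; linarith)).exists_cliqueFree_cliqueFree
    exact not_arrows_of_le_sup hle (not_isContained_of_eq_top f₁ w₁.symm t₁)
      (not_isContained_of_eq_top f₂ w₂.symm t₂)
  · intro hA
    exact not_arrows_of_not_colorable h0 hG (hd₂ w₂)
      (not_colorable_of_three w₁.symm (h₁.eq_top h1' w₁.symm).2.1) hA.symm
  · exact not_arrows_of_not_colorable h0 hG (hd₁ w₁)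
      (not_colorable_of_three w₂.symm (h₂.eq_top h1 w₂.symm).2.1)
  · by_cases c₂ : H₂.Colorable 2
    · by_cases c₁ : H₁.Colorable 2
      · exact not_arrows_of_colorable h1 hG w₁ w₂ he₁ he₂ (hd₁ w₁) (hd₂ w₂) c₁ c₂
      · exact fun hA => not_arrows_of_not_colorable h0 hG (hd₂ w₂) c₁ hA.symm
    · exact not_arrows_of_not_colorable h0 hG (hd₁ w₁) c₂

/-- With `j = ⌈m⌉ - 2 < m - 1`, the hypotheses on `H₁` give `j v(H₁) < e(H₁)`, so `G` is split with
densities `j` and 2. -/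
theorem not_arrows_of_two_lt_maxDensity {m : ℝ} (h1 : 1 < m) (hG : G.maxDensity ≤ m)
    (he : m * (H₁.numVerts - 2) + 1 < H₁.numEdges) (he1 : 1 ≤ H₁.numEdges)
    (hv : 2 * m < H₁.numVerts + 1) (hH : 2 < H₂.maxDensity) : ¬ G.Arrows H₁ H₂ := by
  have := Fintype.ofFinite U
  have hc := Nat.ceil_lt_add_one (zero_le_one.trans h1.le)
  have hc' := Nat.le_ceil m
  obtain ⟨j, hj⟩ : ∃ j, ⌈m⌉₊ = j + 2 := ⟨⌈m⌉₊ - 2, by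
    have : 1 < ⌈m⌉₊ := Nat.lt_ceil.2 (by exact_mod_cast h1)
    omega⟩
  rw [hj] at hc hc'
  push_cast at hc hc'
  obtain ⟨J, hJ⟩ := exists_lt_of_lt_ciSup (f := fun J : H₂.Subgraph => J.coe.density) hH
  unfold density at hJ
  split_ifs at hJ with hJv
  · rw [lt_div_iff₀ (by exact_mod_cast hJv)] at hJ
    have hJ' : 2 * J.coe.numVerts < J.coe.numEdges := by exact_mod_cast hJ
    obtain ⟨G₁, G₂, hle, h₁, h₂⟩ := exists_isSparse_zero_zero (G := G) (k₁ := j) (k₂ := 2)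
      (by push_cast; linarith)
    refine not_arrows_of_le_sup hle (h₁.not_isContained_self (by positivity) he1 ?_)
      (h₂.not_isContained (by positivity) J (by omega) (by push_cast; omega))
    have : (j * H₁.numVerts - 0 : ℝ) < H₁.numEdges := by
      nlinarith [mul_nonneg (show 0 ≤ m - 1 - j by linarith)
        (Nat.cast_nonneg (α := ℝ) H₁.numVerts)]
    exact_mod_cast this
  · norm_num at hJ

omit [Finite V] in
theorem exists_lt_numEdges_of_lt_maxOneDensity {l : ℕ} (h : l < H₁.maxOneDensity) :
    ∃ J : H₁.Subgraph, 1 ≤ J.coe.numEdges ∧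
      (l : ℤ) * J.coe.numVerts - l < J.coe.numEdges := by
  obtain ⟨J, hJ⟩ := exists_lt_of_lt_ciSup (f := fun J : H₁.Subgraph => J.coe.oneDensity) h
  unfold oneDensity at hJ
  split_ifs at hJ with hv
  · have hv' : (2 : ℝ) ≤ J.coe.numVerts := by exact_mod_cast hv
    rw [lt_div_iff₀ (by linarith)] at hJ
    have h1 : (l * J.coe.numVerts - l : ℝ) < J.coe.numEdges := by linarith
    refine ⟨J, ?_, by exact_mod_cast h1⟩
    have : (0 : ℝ) < J.coe.numEdges :=
      lt_of_le_of_lt (mul_nonneg (Nat.cast_nonneg l) (by linarith)) hJ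
    exact_mod_cast this
  · exact absurd hJ (not_lt.2 (Nat.cast_nonneg l))

omit [Finite V] in
theorem exists_lt_numEdges_of_lt_maxDensity {l : ℕ} (h : l < H₁.maxDensity) :
    ∃ J : H₁.Subgraph, 1 ≤ J.coe.numEdges ∧
      (l : ℤ) * J.coe.numVerts - 0 < J.coe.numEdges := by
  obtain ⟨J, hJ⟩ := exists_lt_of_lt_ciSup (f := fun J : H₁.Subgraph => J.coe.density) h
  unfold density at hJ
  split_ifs at hJ with hv
  · have hv' : (1 : ℝ) ≤ J.coe.numVerts := by exact_mod_cast hv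
    rw [lt_div_iff₀ (by linarith)] at hJ
    have h1 : (l * J.coe.numVerts - 0 : ℝ) < J.coe.numEdges := by linarith
    refine ⟨J, ?_, by exact_mod_cast h1⟩
    have : (0 : ℝ) < J.coe.numEdges :=
      lt_of_le_of_lt (mul_nonneg (Nat.cast_nonneg l) (by linarith)) hJ
    exact_mod_cast this
  · exact absurd hJ (not_lt.2 (Nat.cast_nonneg l))

theorem not_arrows_of_two_lt_maxOneDensity {m : ℝ} (h1 : 1 < m) (hG : G.maxDensity ≤ m)
    (he : m * (H₁.numVerts - 2) + 1 < H₁.numEdges) (he1 : 1 ≤ H₁.numEdges)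
    (hv1 : 1 ≤ H₁.numVerts)
    (hv : 2 * m < H₁.numVerts + 1) (hH : 2 < H₂.maxOneDensity) : ¬ G.Arrows H₁ H₂ := by
  have := Fintype.ofFinite U
  -- Forest-type bounds need `m + 1/2 ≤ j + 2`; rounding gives `j < m - 1/2`, still small enough for
  -- `j (v(H₁) - 1) < e(H₁)`.
  have hc := Nat.ceil_lt_add_one (show 0 ≤ m + 1 / 2 by linarith)
  have hc' := Nat.le_ceil (m + 1 / 2)
  obtain ⟨j, hj⟩ : ∃ j, ⌈m + 1 / 2⌉₊ = j + 2 := ⟨⌈m + 1 / 2⌉₊ - 2, by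
    have : 1 < ⌈m + 1 / 2⌉₊ := Nat.lt_ceil.2 (by push_cast; linarith)
    omega⟩
  rw [hj] at hc hc'
  push_cast at hc hc'
  obtain ⟨J, hJ1, hJ⟩ := exists_lt_numEdges_of_lt_maxOneDensity (l := 2) (by exact_mod_cast hH)
  obtain ⟨G₁, G₂, hle, h₁, h₂⟩ := exists_isSparse_self_self (G := G) (k₁ := j) (k₂ := 2)
    (by push_cast; linarith)
  refine not_arrows_of_le_sup hle (h₁.not_isContained_self (by positivity) he1 ?_)
    (h₂.not_isContained (by positivity) J hJ1 hJ)
  have hv1' : (1 : ℝ) ≤ H₁.numVerts := by exact_mod_cast hv1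
  have : (j * H₁.numVerts - j : ℝ) < H₁.numEdges := by
    nlinarith [mul_nonneg (show 0 ≤ m - 1 / 2 - j by linarith)
      (show (0 : ℝ) ≤ H₁.numVerts - 1 by linarith)]
  exact_mod_cast this

omit [Finite V] in
theorem not_arrows_completeGraph {m : ℝ} {a : ℕ} (ha : 3 ≤ a) (hG : G.maxDensity ≤ m)
    (hv : 2 * m < H₁.numVerts + 1) (e : H₁ ≃g completeGraph (Fin a))
    (h₂ : H₂.IsStrictlyTwoBalanced) (h1 : 1 < H₂.maxTwoDensity) : ¬ G.Arrows H₁ H₂ := by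
  have hva : H₁.numVerts = a := by rw [numVerts_congr e]; simp [numVerts]
  have : Nonempty W :=
    (Nat.card_pos_iff.1 (show 0 < H₂.numVerts by have := (h₂.numEdges_eq h1).1; omega)).1
  obtain ⟨G₁, G₂, hle, f₁, f₂⟩ := (isDegenerate_of_maxDensity (G := G) (D := a)
    (by rw [hva] at hv; linarith)).exists_cliqueFree_degenerate ha
  refine not_arrows_of_le_sup hle (fun hc => ?_) (f₂.not_isContained (h₂.one_lt_degree h1))
  exact (not_cliqueFree_iff_top_isContained a).2 (IsContained.trans ⟨e.symm.toCopy⟩ hc) f₁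

/-- If `H₁` is bipartite, then the second colour class can be chosen as a forest. -/
theorem not_arrows_of_left_colorable {m : ℝ} (h1 : 1 < m) (hG : G.maxDensity ≤ m)
    (he : m * (H₁.numVerts - 2) + 1 < H₁.numEdges) (he1 : 1 ≤ H₁.numEdges)
    (hv : 3 ≤ H₁.numVerts) (hc : H₁.Colorable 2) (h₂ : H₂.numVerts ≤ H₂.numEdges)
    (h₂' : 1 ≤ H₂.numEdges) : ¬ G.Arrows H₁ H₂ := by
  have := Fintype.ofFinite U
  have h4 := four_mul_numEdges_le hc
  have hk := Nat.floor_le (zero_le_one.trans h1.le)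
  have hk' := Nat.lt_floor_add_one m
  have hk1 : 1 ≤ ⌊m⌋₊ := Nat.le_floor (by exact_mod_cast h1.le)
  set k := ⌊m⌋₊
  set v := H₁.numVerts
  have hk1' : (1 : ℝ) ≤ k := by exact_mod_cast hk1
  have hv' : (3 : ℝ) ≤ v := by exact_mod_cast hv
  have h4' : (4 * H₁.numEdges : ℝ) ≤ v ^ 2 := by exact_mod_cast h4
  have hvm : 4 * m < v + 2 := by
    refine lt_of_mul_lt_mul_right (a := (v : ℝ) - 2) ?_ (by linarith)
    nlinarith
  -- This follows from `4k < v + 2` unless `k = 1` and `v = 3`, where a bipartite graph has too few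
  -- edges.
  have hvk : 2 * k + 2 ≤ v := by
    have h5 : (4 * k : ℝ) < v + 2 := by linarith
    have h6 : 4 * k < v + 2 := by exact_mod_cast h5
    by_contra hcon
    have h7 : v = 3 := by omega
    rw [h7] at h4 he
    push_cast at he
    have : (2 : ℝ) < H₁.numEdges := by linarith
    have : 2 < H₁.numEdges := by exact_mod_cast this
    omega
  have hvk' : (2 * k + 2 : ℝ) ≤ v := by exact_mod_cast hvk
  have hθ : (m - k) * (2 * k) ≤ (m - k) * (v - 2) :=
    mul_le_mul_of_nonneg_left (by linarith) (by linarith)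
  -- `L = k v + 1 - e(H₁)`, truncated at 0, is the least natural number for which the bound `k v -
  -- L` excludes `H₁`; the inequality is the hypothesis of `exists_isSparse_forest_count`.
  have hL : ((k * v + 1 - H₁.numEdges : ℕ) : ℝ) < 2 * k * (k + 1 - m) := by
    rcases le_total H₁.numEdges (k * v + 1) with h | h
    · rw [Nat.cast_sub h]
      push_cast
      linarith
    · rw [Nat.sub_eq_zero_of_le h]
      push_cast
      exact mul_pos (by linarith) (by linarith)
  have hL' : k * v + 1 - H₁.numEdges < 2 * k := by
    have : ((k * v + 1 - H₁.numEdges : ℕ) : ℝ) < 2 * k := by nlinarith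
    exact_mod_cast this
  obtain ⟨G₁, G₂, hle, s₁, s₂⟩ := exists_isSparse_forest_count (G := G) hk1 hL' (by
    have : ((k * v + 1 - H₁.numEdges : ℕ) : ℝ) / (2 * k) < k + 1 - m := by
      rw [div_lt_iff₀ (by linarith)]; linarith
    linarith)
  refine not_arrows_of_le_sup hle (s₁.not_isContained_self (by positivity) he1 ?_)
    (s₂.not_isContained_self (by positivity) h₂' (by omega))
  have : k * v < H₁.numEdges + (k * v + 1 - H₁.numEdges) := by omega
  zify at this
  linarith

end Decompositions

end SimpleGraph

end

/-! ### The theorem: reduction to the asymmetric case and the listed conditions. -/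

theorem lemma1p9 {U V W : Type*} [Finite U] [Finite V] [Finite W]
    (G : SimpleGraph U) (H₁ : SimpleGraph V) (H₂ : SimpleGraph W)
    (h_ge : H₂.maxTwoDensity ≤ H₁.maxTwoDensity)
    (h_gt : 1 < H₂.maxTwoDensity)
    (hG : G.maxDensity ≤ H₁.maxAsymTwoDensity H₂)
    (hheart : H₁.IsHeart H₂)
    (hcases :
      H₁.maxTwoDensity = H₂.maxTwoDensity ∨
      3 ≤ H₂.chromaticNumber ∨
      2 < H₂.maxDensity ∨
      2 < H₂.maxOneDensity ∨
      (∃ a : ℕ, 3 ≤ a ∧ Nonempty (H₁ ≃g SimpleGraph.completeGraph (Fin a))) ∨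
      (∃ a b : ℕ, 2 ≤ a ∧ 2 ≤ b ∧
        Nonempty (H₁ ≃g completeBipartiteGraph (Fin a) (Fin b))) ∨
      (∃ l : ℕ, (l : ℝ) < H₁.maxOneDensity ∧ H₁.maxAsymTwoDensity H₂ ≤ (l : ℝ) + 1 / 2) ∨
      ((∃ l : ℕ, (l : ℝ) < H₁.maxDensity ∧ H₁.maxAsymTwoDensity H₂ ≤ (l : ℝ) + 1) ∧
        ¬ H₂.IsCycleGraph)) :
    ¬ G.Arrows H₁ H₂ := by
  have := Fintype.ofFinite U
  have hb₂ := hheart.right_balanced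
  rcases h_ge.eq_or_lt with heq | hlt
  · exact SimpleGraph.not_arrows_of_maxTwoDensity_eq (hheart.left_balanced_of_eq heq.symm) hb₂ heq.symm h_gt
      (hG.trans (SimpleGraph.maxAsymTwoDensity_le_of_eq heq.symm h_gt))
  have hb₁ := hheart.left_balanced_of_gt hlt
  have hv₂ := (hb₂.numEdges_eq h_gt).1
  have hve₂ := hb₂.numVerts_le_numEdges h_gt
  have hm := SimpleGraph.maxTwoDensity_lt_maxAsymTwoDensity hlt h_gt (by omega)
  obtain ⟨hv, _, he⟩ := hb₁.numEdges_eq h_gt hm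
  have hdeg := hb₁.lt_degree h_gt hm
  set m := H₁.maxAsymTwoDensity H₂
  have h1 : 1 < m := h_gt.trans hm
  have hv' : (3 : ℝ) ≤ H₁.numVerts := by exact_mod_cast hv
  -- The exact count is `e(H₁) = m (v(H₁) - 2) + m / m₂(H₂)`, and the last ratio exceeds 1.
  have he' : m * (H₁.numVerts - 2) + 1 < H₁.numEdges := by
    have : 1 < m / H₂.maxTwoDensity := (one_lt_div (by linarith)).2 hm
    rw [he, mul_add, mul_one_div]
    linarith
  have he1 : 1 ≤ H₁.numEdges := by
    have : (1 : ℝ) ≤ H₁.numEdges := by nlinarith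
    exact_mod_cast this
  -- Compare with `2e ≤ v(v-1)` and use `v² - v - 2 = (v-2)(v+1)`.
  have hvm : 2 * m < H₁.numVerts + 1 := by
    have h2 : (2 * H₁.numEdges : ℝ) ≤ H₁.numVerts * (H₁.numVerts - 1) := by
      have := SimpleGraph.two_mul_numEdges_le (G := H₁)
      rw [← Nat.cast_pred (R := ℝ) (by omega)]
      exact_mod_cast this
    refine lt_of_mul_lt_mul_right (a := (H₁.numVerts : ℝ) - 2) ?_ (by linarith)
    nlinarith
  rcases hcases with h | h | h | h | ⟨a, ha, ⟨e⟩⟩ | ⟨a, b, _, _, ⟨e⟩⟩ | ⟨l, hl, hl'⟩ |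
    ⟨⟨l, hl, hl'⟩, hcyc⟩
  · exact absurd h hlt.ne'
  · have : Nonempty V := (Nat.card_pos_iff.1 (show 0 < H₁.numVerts by omega)).1
    refine SimpleGraph.not_arrows_of_not_colorable (by linarith) hG hdeg fun hc => ?_
    have h3 := h.trans (SimpleGraph.chromaticNumber_le_iff_colorable.2 hc)
    exact absurd h3 (by decide)
  · exact SimpleGraph.not_arrows_of_two_lt_maxDensity h1 hG he' he1 hvm h
  · exact SimpleGraph.not_arrows_of_two_lt_maxOneDensity h1 hG he' he1 (by omega) hvm h
  · exact SimpleGraph.not_arrows_completeGraph ha hG hvm e hb₂ h_gt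
  · have hc : H₁.Colorable 2 := by
      have := (SimpleGraph.CompleteBipartiteGraph.bicoloring (Fin a) (Fin b)).colorable.of_hom e.toHom
      simpa using this
    exact SimpleGraph.not_arrows_of_left_colorable h1 hG he' he1 hv hc hve₂ (by omega)
  · obtain ⟨J, hJ1, hJ⟩ := SimpleGraph.exists_lt_numEdges_of_lt_maxOneDensity hl
    -- `G₂` is a forest, which excludes `H₂` because `e(H₂) ≥ v(H₂)`.
    obtain ⟨G₁, G₂, hle, s₁, s₂⟩ := SimpleGraph.exists_isSparse_self_self (G := G) (k₁ := l) (k₂ := 1)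
      (by push_cast; linarith)
    exact SimpleGraph.not_arrows_of_le_sup hle (s₁.not_isContained (by positivity) J hJ1 hJ)
      (s₂.not_isContained_self (by positivity) (by omega) (by push_cast; omega))
  · obtain ⟨J, hJ1, hJ⟩ := SimpleGraph.exists_lt_numEdges_of_lt_maxDensity hl
    have := hb₂.numVerts_lt_numEdges h_gt hcyc
    -- `G₂` is only a pseudoforest, so `e(H₂) > v(H₂)` is needed; this is why cycles are excluded.
    obtain ⟨G₁, G₂, hle, s₁, s₂⟩ := SimpleGraph.exists_isSparse_zero_zero (G := G) (k₁ := l) (k₂ := 1)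
      (by push_cast; linarith)
    exact SimpleGraph.not_arrows_of_le_sup hle (s₁.not_isContained (by positivity) J hJ1 hJ)
      (s₂.not_isContained_self (by positivity) (by omega) (by push_cast; omega))
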